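/- For independent real random variables $X_1,X_2,Z_1,Z_2$ with $Z_i\sim\mathcal N(0,N_i)$, consider the objective (with $h$ the differential entropy in nats) $$F(P_{X_1},P_{X_2})=u\,h(X_1+X_2+Z_1+Z_2)+h(X_1+Z_1)-(1+u)\,h(X_1+Z_1+Z_2)-\Sigma_1\,\mathbb E[X_1^2],$$ to be maximized over all laws $P_{X_1},P_{X_2}$ on $\mathbb R$ with $\mathbb E[X_2^2]\le A_2$; when $\Sigma_1>0$, $F$ is read as $-\infty$ if $\mathbb E[X_1^2]=\infty$. (A conjecture of Costa, Nair, Ng and Wang states that the maximum is attained by Gaussian $X_1$ and $X_2$.) Theorem. Let $u=N_1=1$. There exist $N_2=A_2>0$ and $\Sigma_1>0$ such that $$\sup\{F(P_{X_1},P_{X_2}) : \mathbb E[X_2^2]\le A_2\}>0,$$ while the supremum of $F$ restricted to Gaussian $X_2$ (with $\mathbb E[X_2^2]\le A_2$, arbitrary mean, possibly degenerate) and arbitrary $X_1$ is at most $0$. In particular, for these parameters no pair of Gaussian laws attains the maximum, so the conjecture fails with strictly positive $N_1$ and $\Sigma_1$. -/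

import Mathlib

open MeasureTheory ProbabilityTheory
open scoped ENNReal NNReal

noncomputable section

/-- The differential entropy `h(μ) = -∫ f log f` (in nats) of a probability measure `μ` on `ℝ` with
Lebesgue density `f`, as an extended real: the integral of the positive part of `-f log f` minus
the integral of its negative part. It is `-∞` if `μ` has no density. (The difference `∞ - ∞` is
`-∞` in `EReal`; it does not occur for a bounded density, where the second integral is finite.) -/
def differentialEntropy (μ : Measure ℝ) : EReal :=
  open Classical in
  if μ ≪ volume then
    ((∫⁻ x, ENNReal.ofReal (Real.negMulLog (μ.rnDeriv volume x).toReal) : ℝ≥0∞) : EReal)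
      - ((∫⁻ x, ENNReal.ofReal (-Real.negMulLog (μ.rnDeriv volume x).toReal) : ℝ≥0∞) : EReal)
  else ⊥

/-- The second moment `E[X²] ∈ [0, ∞]` of a random variable `X` with law `μ`. -/
def secondMoment (μ : Measure ℝ) : ℝ≥0∞ := ∫⁻ x, ENNReal.ofReal (x ^ 2) ∂μ

/-- The objective
`u h(X₁+X₂+Z₁+Z₂) + h(X₁+Z₁) - (1+u) h(X₁+Z₁+Z₂) - S₁ E[X₁²]`
in dimension one, as a function of the pair `P` of the laws of `X₁` and `X₂`, where `Z₁ ∼ N(0,N₁)`,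
`Z₂ ∼ N(0,N₂)` and `X₁, X₂, Z₁, Z₂` are independent, so that the laws of the sums are
convolutions. If `N₁, S₁ > 0` and `E[X₁²] = ∞`, the value is `-∞`. -/
def zObjective (u N₁ N₂ S₁ : ℝ≥0) (P : Measure ℝ × Measure ℝ) : EReal :=
  ((u : ℝ) : EReal) *
      differentialEntropy (P.1.conv (P.2.conv ((gaussianReal 0 N₁).conv (gaussianReal 0 N₂))))
    + differentialEntropy (P.1.conv (gaussianReal 0 N₁))
    - ((1 + u : ℝ) : EReal) *
      differentialEntropy (P.1.conv ((gaussianReal 0 N₁).conv (gaussianReal 0 N₂)))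
    - ((S₁ : ℝ) : EReal) * (secondMoment P.1 : EReal)

/-- The admissible pairs of input laws: probability laws of `X₁` and `X₂` with `E[X₂²] ≤ A₂`. -/
def zFeasible (A₂ : ℝ≥0) : Set (Measure ℝ × Measure ℝ) :=
  {P | IsProbabilityMeasure P.1 ∧ IsProbabilityMeasure P.2 ∧ secondMoment P.2 ≤ (A₂ : ℝ≥0∞)}

end

/-! Write `h(ρ)` for the entropy of `ρ` convolved with `N(0,1)`. Up to the power cost, the objective
is the gap `h(X₁+X₂+Z₂) + h(X₁) - 2 h(X₁+Z₂)`. If `X₂` is Gaussian with variance at most `N₂`,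
submodularity (`smoothEntropy_submodular`) bounds the first two terms by `h(X₁+X₂) + h(X₁+Z₂)`, and
`h(X₁+X₂) ≤ h(X₁+Z₂)` because a further independent Gaussian turns `X₂` into `Z₂`. So the gap is
never positive, whatever `X₁` is.

For a non-Gaussian `X₂` the second step breaks down. Take `N₂ = A₂ = ε²` and `X₂ = εV` with `V` of
mean 0, variance 1 and nonzero third moment, and let `f` be the log-density of `X₁+Z₁`. Replacing
each entropy by its cross-entropy against `f` costs nothing for `X₁+Z₂` (Gibbs, in the favourable
direction) and a relative entropy for `X₁+X₂+Z₂`. By data processing that is at most the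
`χ²`-divergence of a small centred perturbation of `N(0,1)`, hence `O(ε⁴)`. In the Taylor expansion
of the cross-entropies the orders 0, 1 and 2 cancel, since `X₂+Z₂` has twice the variance of `Z₂`,
and the gap is at least `-(ε³/6) E[V³] E[f'''] - O(ε⁴)` (`exists_entropyGap_ge`). Two-point laws
make `E[f''']` positive and `E[V³]` negative. A small enough power price then keeps the value
positive. -/

/-! ### Integrated exponential inequality, the source of every entropy inequality below -/

lemma ofReal_integral_le_lintegral_ofReal {Ω : Type*} [MeasurableSpace Ω] {μ : Measure Ω}
    {f : Ω → ℝ} (hf : Integrable f μ) :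
    ENNReal.ofReal (∫ x, f x ∂μ) ≤ ∫⁻ x, ENNReal.ofReal (f x) ∂μ := by
  calc ENNReal.ofReal (∫ x, f x ∂μ) ≤ ENNReal.ofReal (∫ x, max (f x) 0 ∂μ) :=
        ENNReal.ofReal_le_ofReal (integral_mono hf hf.pos_part fun x ↦ le_max_left _ _)
    _ = ∫⁻ x, ENNReal.ofReal (max (f x) 0) ∂μ :=
        ofReal_integral_eq_lintegral_ofReal hf.pos_part (ae_of_all _ fun x ↦ le_max_right _ _)
    _ = _ := by simp [ENNReal.ofReal_max]

/-- The inequality `L + 1 ≤ exp L`, integrated. -/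
lemma integral_le_of_lintegral_exp_le {Ω : Type*} [MeasurableSpace Ω] {μ : Measure Ω}
    [IsProbabilityMeasure μ] {L : Ω → ℝ} (hL : Integrable L μ) {C : ℝ} (hC : 0 ≤ C)
    (h : ∫⁻ x, ENNReal.ofReal (Real.exp (L x)) ∂μ ≤ ENNReal.ofReal C) : ∫ x, L x ∂μ ≤ C - 1 := by
  have h1 : ∫ x, (L x + 1) ∂μ = ∫ x, L x ∂μ + 1 := by
    rw [integral_add hL (integrable_const _)]; simp
  have h2 : ∫ x, (L x + 1) ∂μ ≤ C := by
    rw [← ENNReal.ofReal_le_ofReal_iff hC]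
    refine (ofReal_integral_le_lintegral_ofReal (hL.add (integrable_const _))).trans
      (le_trans (lintegral_mono fun x ↦ ?_) h)
    exact ENNReal.ofReal_le_ofReal (Real.add_one_le_exp _)
  linarith

/-! ### Densities and entropies of Gaussian smoothings -/

/-- The density at `y` of the convolution of `ρ` with the standard Gaussian law. -/
noncomputable def smoothDensity (ρ : Measure ℝ) (y : ℝ) : ℝ≥0∞ := ∫⁻ x, gaussianPDF 0 1 (y - x) ∂ρ

/-- The logarithm of the density of the convolution of `ρ` with the standard Gaussian law. -/
noncomputable def logDensity (ρ : Measure ℝ) (y : ℝ) : ℝ := Real.log (smoothDensity ρ y).toReal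

/-- The entropy of the convolution of `ρ` with the standard Gaussian law, as a real number. -/
noncomputable def smoothEntropy (ρ : Measure ℝ) : ℝ :=
  -∫ y, logDensity ρ y ∂(ρ.conv (gaussianReal 0 1))

lemma gaussianPDF_zero_one (y : ℝ) :
    gaussianPDF 0 1 y = ENNReal.ofReal ((√(2 * Real.pi))⁻¹ * Real.exp (-y ^ 2 / 2)) := by
  simp [gaussianPDF, gaussianPDFReal]

lemma gaussianPDF_le_one (y : ℝ) : gaussianPDF 0 1 y ≤ 1 := by
  rw [gaussianPDF_zero_one]
  refine ENNReal.ofReal_le_one.2 ?_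
  have h1 : (1 : ℝ) ≤ √(2 * Real.pi) := by
    rw [Real.one_le_sqrt]; linarith [Real.pi_gt_three]
  have h2 : Real.exp (-y ^ 2 / 2) ≤ 1 := by
    rw [Real.exp_le_one_iff]; nlinarith [sq_nonneg y]
  exact mul_le_one₀ (inv_le_one_of_one_le₀ h1) (Real.exp_pos _).le h2

@[fun_prop]
lemma measurable_smoothDensity (ρ : Measure ℝ) [SFinite ρ] : Measurable (smoothDensity ρ) := by
  unfold smoothDensity
  refine Measurable.lintegral_prod_right' (f := fun p : ℝ × ℝ ↦ gaussianPDF 0 1 (p.1 - p.2)) ?_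
  exact (measurable_gaussianPDF 0 1).comp (by fun_prop)

@[fun_prop]
lemma measurable_logDensity (ρ : Measure ℝ) [SFinite ρ] : Measurable (logDensity ρ) := by
  unfold logDensity
  fun_prop

lemma smoothDensity_le_one (ρ : Measure ℝ) [IsProbabilityMeasure ρ] (y : ℝ) :
    smoothDensity ρ y ≤ 1 := by
  calc smoothDensity ρ y ≤ ∫⁻ _, 1 ∂ρ := lintegral_mono fun x ↦ gaussianPDF_le_one _
    _ = 1 := by simp

lemma smoothDensity_ne_top (ρ : Measure ℝ) [IsProbabilityMeasure ρ] (y : ℝ) :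
    smoothDensity ρ y ≠ ∞ := ((smoothDensity_le_one ρ y).trans_lt ENNReal.one_lt_top).ne

lemma smoothDensity_pos (ρ : Measure ℝ) [IsProbabilityMeasure ρ] (y : ℝ) :
    0 < smoothDensity ρ y := by
  have hm : Measurable fun x ↦ gaussianPDF 0 1 (y - x) :=
    (measurable_gaussianPDF 0 1).comp (by fun_prop)
  unfold smoothDensity
  rw [lintegral_pos_iff_support hm]
  have : (Function.support fun x ↦ gaussianPDF 0 1 (y - x)) = Set.univ := by
    ext x; simp [(gaussianPDF_pos 0 one_ne_zero (y - x)).ne']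
  simp [this]

lemma smoothDensity_toReal_pos (ρ : Measure ℝ) [IsProbabilityMeasure ρ] (y : ℝ) :
    0 < (smoothDensity ρ y).toReal :=
  ENNReal.toReal_pos (smoothDensity_pos ρ y).ne' (smoothDensity_ne_top ρ y)

lemma ofReal_exp_logDensity (ρ : Measure ℝ) [IsProbabilityMeasure ρ] (y : ℝ) :
    ENNReal.ofReal (Real.exp (logDensity ρ y)) = smoothDensity ρ y := by
  rw [logDensity, Real.exp_log (smoothDensity_toReal_pos ρ y),
    ENNReal.ofReal_toReal (smoothDensity_ne_top ρ y)]

lemma ofReal_exp_neg_logDensity (ρ : Measure ℝ) [IsProbabilityMeasure ρ] (y : ℝ) :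
    ENNReal.ofReal (Real.exp (-logDensity ρ y)) = (smoothDensity ρ y)⁻¹ := by
  rw [Real.exp_neg, ENNReal.ofReal_inv_of_pos (Real.exp_pos _), ofReal_exp_logDensity]

lemma logDensity_nonpos (ρ : Measure ℝ) [IsProbabilityMeasure ρ] (y : ℝ) :
    logDensity ρ y ≤ 0 := by
  refine Real.log_nonpos ENNReal.toReal_nonneg ?_
  simpa using ENNReal.toReal_mono ENNReal.one_ne_top (smoothDensity_le_one ρ y)

lemma conv_gaussianReal_eq_withDensity (ρ : Measure ℝ) [IsProbabilityMeasure ρ] :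
    ρ.conv (gaussianReal 0 1) = volume.withDensity (smoothDensity ρ) := by
  refine Measure.ext_of_lintegral _ fun f hf ↦ ?_
  rw [Measure.lintegral_conv hf, lintegral_withDensity_eq_lintegral_mul _ (by fun_prop) hf]
  have h (x : ℝ) : ∫⁻ y, f (x + y) ∂(gaussianReal 0 1) =
      ∫⁻ y, gaussianPDF 0 1 (y - x) * f y := by
    rw [gaussianReal_of_var_ne_zero _ one_ne_zero, lintegral_withDensity_eq_lintegral_mul _
      (measurable_gaussianPDF 0 1) (by fun_prop),
      ← lintegral_add_left_eq_self (fun y ↦ gaussianPDF 0 1 (y - x) * f y) x]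
    simp
  simp_rw [h]
  rw [lintegral_lintegral_swap]
  · refine lintegral_congr fun y ↦ ?_
    rw [Pi.mul_apply, smoothDensity, lintegral_mul_const]
    exact (measurable_gaussianPDF 0 1).comp (by fun_prop)
  · refine Measurable.aemeasurable ?_
    exact ((measurable_gaussianPDF 0 1).comp (by fun_prop)).mul (hf.comp measurable_snd)

lemma lintegral_conv_gaussianReal (ρ : Measure ℝ) [IsProbabilityMeasure ρ] {f : ℝ → ℝ≥0∞}
    (hf : Measurable f) :
    ∫⁻ y, f y ∂(ρ.conv (gaussianReal 0 1)) = ∫⁻ y, smoothDensity ρ y * f y := by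
  rw [conv_gaussianReal_eq_withDensity, lintegral_withDensity_eq_lintegral_mul _ (by fun_prop) hf]
  rfl

lemma lintegral_smoothDensity (ρ : Measure ℝ) [IsProbabilityMeasure ρ] :
    ∫⁻ y, smoothDensity ρ y = 1 := by
  simpa using (lintegral_conv_gaussianReal ρ (f := fun _ ↦ 1) measurable_const).symm

lemma smoothDensity_conv (ρ α : Measure ℝ) [IsProbabilityMeasure ρ] [IsProbabilityMeasure α]
    (y : ℝ) : smoothDensity (ρ.conv α) y = ∫⁻ a, smoothDensity ρ (y - a) ∂α := by
  have hm : Measurable fun x ↦ gaussianPDF 0 1 (y - x) :=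
    (measurable_gaussianPDF 0 1).comp (by fun_prop)
  rw [Measure.conv_comm, smoothDensity, Measure.lintegral_conv hm]
  simp_rw [smoothDensity, sub_add_eq_sub_sub]

lemma integrable_sq_conv {ρ α : Measure ℝ} [IsProbabilityMeasure ρ] [IsProbabilityMeasure α]
    (hρ : Integrable (fun x ↦ x ^ 2) ρ) (hα : Integrable (fun x ↦ x ^ 2) α) :
    Integrable (fun x ↦ x ^ 2) (ρ.conv α) := by
  rw [Measure.conv, integrable_map_measure (by fun_prop) (by fun_prop)]
  refine Integrable.mono' (((hρ.comp_fst α).add (hα.comp_snd ρ)).const_mul 2) (by fun_prop)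
    (ae_of_all _ fun p ↦ ?_)
  simp only [Function.comp_apply, norm_pow, Real.norm_eq_abs, sq_abs, Pi.add_apply]
  nlinarith [sq_nonneg (p.1 - p.2)]

lemma integrable_sq_gaussianReal (m : ℝ) (v : ℝ≥0) :
    Integrable (fun x ↦ x ^ 2) (gaussianReal m v) := by
  simpa using (memLp_id_gaussianReal (μ := m) (v := v) 2).integrable_sq

/-- Integrate over `x` the bounds `exp (-(y - x)² / 2) ≥ exp (-y² - x²)` and `exp (m - x²) ≥ 1 + m -
x²`. Together with `logDensity ≤ 0`, this quadratic minorant makes log-densities integrable under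
every law with a second moment. -/
lemma le_logDensity (ρ : Measure ℝ) [IsProbabilityMeasure ρ]
    (hρ : Integrable (fun x ↦ x ^ 2) ρ) (y : ℝ) :
    -Real.log (√(2 * Real.pi)) - y ^ 2 - ∫ x, x ^ 2 ∂ρ ≤ logDensity ρ y := by
  set m := ∫ x, x ^ 2 ∂ρ
  have hpi : 0 < √(2 * Real.pi) := by positivity
  rw [logDensity, Real.le_log_iff_exp_le (smoothDensity_toReal_pos ρ y),
    ← ENNReal.ofReal_le_iff_le_toReal (smoothDensity_ne_top ρ y)]
  have hint : Integrable (fun x : ℝ ↦ (√(2 * Real.pi))⁻¹ * Real.exp (-y ^ 2 - m) *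
      (1 + m - x ^ 2)) ρ := ((integrable_const _).sub hρ).const_mul _
  have hI : ∫ x, (√(2 * Real.pi))⁻¹ * Real.exp (-y ^ 2 - m) * (1 + m - x ^ 2) ∂ρ =
      Real.exp (-Real.log (√(2 * Real.pi)) - y ^ 2 - m) := by
    rw [integral_const_mul, integral_sub (integrable_const _) hρ]
    simp only [integral_const, probReal_univ, smul_eq_mul, one_mul]
    rw [show -Real.log (√(2 * Real.pi)) - y ^ 2 - m = -Real.log (√(2 * Real.pi)) + (- y ^ 2 - m)
      by ring, Real.exp_add (-Real.log _), Real.exp_neg (Real.log _), Real.exp_log hpi]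
    change _ * (1 + m - m) = _
    ring
  rw [← hI]
  calc _ ≤ ∫⁻ x, ENNReal.ofReal ((√(2 * Real.pi))⁻¹ * Real.exp (-y ^ 2 - m) *
        (1 + m - x ^ 2)) ∂ρ := ofReal_integral_le_lintegral_ofReal hint
    _ ≤ _ := by
      refine lintegral_mono fun x ↦ ?_
      rw [gaussianPDF_zero_one]
      refine ENNReal.ofReal_le_ofReal ?_
      rw [mul_assoc]
      refine mul_le_mul_of_nonneg_left ?_ (by positivity)
      calc Real.exp (-y ^ 2 - m) * (1 + m - x ^ 2)
          ≤ Real.exp (-y ^ 2 - m) * Real.exp (m - x ^ 2) := by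
            gcongr; linarith [Real.add_one_le_exp (m - x ^ 2)]
        _ = Real.exp (-y ^ 2 - x ^ 2) := by rw [← Real.exp_add]; ring_nf
        _ ≤ Real.exp (-(y - x) ^ 2 / 2) := by
            gcongr; nlinarith [sq_nonneg (y + x)]

lemma integrable_logDensity (ρ : Measure ℝ) [IsProbabilityMeasure ρ]
    (hρ : Integrable (fun x ↦ x ^ 2) ρ) {μ : Measure ℝ} [IsProbabilityMeasure μ]
    (hμ : Integrable (fun x ↦ x ^ 2) μ) : Integrable (logDensity ρ) μ := by
  refine Integrable.mono' ((integrable_const (Real.log (√(2 * Real.pi)) + ∫ x, x ^ 2 ∂ρ)).add hμ)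
    (by fun_prop) (ae_of_all _ fun y ↦ ?_)
  rw [Real.norm_eq_abs, abs_of_nonpos (logDensity_nonpos ρ y)]
  simp only [Pi.add_apply]
  linarith [le_logDensity ρ hρ y]

/-- The smoothed density is at most 1, so `-f log f` has no negative part and the extended-real
difference is harmless. -/
lemma differentialEntropy_conv_gaussianReal (ρ : Measure ℝ) [IsProbabilityMeasure ρ]
    (hρ : Integrable (fun x ↦ x ^ 2) ρ) :
    differentialEntropy (ρ.conv (gaussianReal 0 1)) = (smoothEntropy ρ : EReal) := by
  have hac : ρ.conv (gaussianReal 0 1) ≪ volume := by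
    rw [conv_gaussianReal_eq_withDensity]; exact withDensity_absolutelyContinuous _ _
  have hrn : (ρ.conv (gaussianReal 0 1)).rnDeriv volume =ᵐ[volume] smoothDensity ρ := by
    rw [conv_gaussianReal_eq_withDensity]
    exact Measure.rnDeriv_withDensity _ (by fun_prop)
  have hint : Integrable (logDensity ρ) (ρ.conv (gaussianReal 0 1)) :=
    integrable_logDensity ρ hρ (integrable_sq_conv hρ (integrable_sq_gaussianReal _ _))
  have hneg : ∫⁻ x, ENNReal.ofReal (-Real.negMulLog
      ((ρ.conv (gaussianReal 0 1)).rnDeriv volume x).toReal) = 0 := by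
    rw [lintegral_eq_zero_iff (by fun_prop)]
    filter_upwards [hrn] with x hx
    rw [hx, Pi.zero_apply, ENNReal.ofReal_eq_zero, neg_nonpos]
    refine Real.negMulLog_nonneg ENNReal.toReal_nonneg ?_
    simpa using ENNReal.toReal_mono ENNReal.one_ne_top (smoothDensity_le_one ρ x)
  have hpos : ∫⁻ x, ENNReal.ofReal (Real.negMulLog
      ((ρ.conv (gaussianReal 0 1)).rnDeriv volume x).toReal) =
        ENNReal.ofReal (smoothEntropy ρ) := by
    rw [smoothEntropy, ← integral_neg, ofReal_integral_eq_lintegral_ofReal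
      (f := fun y ↦ -logDensity ρ y) hint.neg
      (ae_of_all _ fun y ↦ by simpa using logDensity_nonpos ρ y),
      lintegral_conv_gaussianReal ρ (by fun_prop)]
    refine lintegral_congr_ae ?_
    filter_upwards [hrn] with x hx
    rw [hx, Real.negMulLog, neg_mul, ← mul_neg, ENNReal.ofReal_mul ENNReal.toReal_nonneg,
      ENNReal.ofReal_toReal (smoothDensity_ne_top ρ x)]
    rfl
  have hent : 0 ≤ smoothEntropy ρ := by
    rw [smoothEntropy, ← integral_neg]
    exact integral_nonneg fun y ↦ by simpa using logDensity_nonpos ρ y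
  rw [differentialEntropy, if_pos hac, hneg, hpos]
  simp [EReal.coe_ennreal_ofReal, max_eq_left hent]

/-! ### Entropy inequalities for sums of independent variables -/

lemma conv_right_comm (ρ α β : Measure ℝ) [SFinite ρ] [SFinite α] [SFinite β] :
    (ρ.conv α).conv β = (ρ.conv β).conv α := by
  rw [Measure.conv_assoc, Measure.conv_comm α β, ← Measure.conv_assoc]

lemma measurePreserving_add_conv (μ α : Measure ℝ) :
    MeasurePreserving (fun p : ℝ × ℝ ↦ p.1 + p.2) (μ.prod α) (μ.conv α) :=
  ⟨by fun_prop, rfl⟩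

/-- By Bayes, `φ(s - x) / p_ρ(s)` is the posterior density of the input given the output `s`, so it
integrates to 1 against `ρ`. -/
lemma lintegral_lintegral_ratio_mul_gaussianPDF (ρ τ : Measure ℝ) [IsProbabilityMeasure ρ]
    [IsProbabilityMeasure τ] :
    ∫⁻ x, (∫⁻ s, smoothDensity τ s * (smoothDensity ρ s)⁻¹ * gaussianPDF 0 1 (s - x)) ∂ρ =
      ∫⁻ s, smoothDensity τ s := by
  have hm : Measurable fun p : ℝ × ℝ ↦ gaussianPDF 0 1 (p.2 - p.1) :=
    (measurable_gaussianPDF 0 1).comp (measurable_snd.sub measurable_fst)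
  have hr : Measurable fun s ↦ smoothDensity τ s * (smoothDensity ρ s)⁻¹ := by fun_prop
  have hm2 : Measurable (Function.uncurry fun x s ↦ smoothDensity τ s * (smoothDensity ρ s)⁻¹ *
      gaussianPDF 0 1 (s - x)) := (hr.comp measurable_snd).mul hm
  rw [lintegral_lintegral_swap hm2.aemeasurable]
  refine lintegral_congr fun s ↦ ?_
  have hm' : Measurable fun x ↦ gaussianPDF 0 1 (s - x) :=
    (measurable_gaussianPDF 0 1).comp (by fun_prop)
  have h1 : ∫⁻ x, gaussianPDF 0 1 (s - x) ∂ρ = smoothDensity ρ s := by rw [smoothDensity]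
  rw [lintegral_const_mul _ hm', h1, mul_assoc, ENNReal.inv_mul_cancel (smoothDensity_pos ρ s).ne'
    (smoothDensity_ne_top ρ s), mul_one]

section
variable {ρ α β : Measure ℝ} [IsProbabilityMeasure ρ] [IsProbabilityMeasure α]
  [IsProbabilityMeasure β]

lemma integrable_logDensity_conv (hρ : Integrable (fun x ↦ x ^ 2) ρ)
    (hα : Integrable (fun x ↦ x ^ 2) α) :
    Integrable (logDensity ρ) (α.conv (gaussianReal 0 1)) :=
  integrable_logDensity ρ hρ (integrable_sq_conv hα (integrable_sq_gaussianReal _ _))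

/-- Gibbs' inequality: the exponential inequality applied to `log (p_α / p_ρ)`. -/
lemma smoothEntropy_le_crossEntropy (hρ : Integrable (fun x ↦ x ^ 2) ρ)
    (hα : Integrable (fun x ↦ x ^ 2) α) :
    smoothEntropy ρ ≤ -∫ y, logDensity α y ∂(ρ.conv (gaussianReal 0 1)) := by
  have h1 := integrable_logDensity_conv hρ hρ
  have h2 := integrable_logDensity_conv hα hρ
  have := integral_le_of_lintegral_exp_le (h2.sub h1) zero_le_one (by
    simp only [Pi.sub_apply, sub_eq_add_neg, Real.exp_add, ENNReal.ofReal_mul (Real.exp_pos _).le,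
      ofReal_exp_logDensity, ofReal_exp_neg_logDensity]
    rw [lintegral_conv_gaussianReal _ (by fun_prop)]
    calc _ = ∫⁻ y, smoothDensity α y := by
          refine lintegral_congr fun y ↦ ?_
          rw [mul_left_comm, ENNReal.mul_inv_cancel (smoothDensity_pos ρ y).ne'
            (smoothDensity_ne_top ρ y), mul_one]
      _ ≤ _ := by simp [lintegral_smoothDensity])
  simp only [Pi.sub_apply] at this
  rw [integral_sub h2 h1] at this
  rw [smoothEntropy]
  linarith

/-- Conditioning on the added variable `A` reduces entropy: `p_{ρ*α}(Y + A) / p_ρ(Y)` has mean 1, by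
translation invariance for each fixed `A`. -/
lemma smoothEntropy_le_smoothEntropy_conv (hρ : Integrable (fun x ↦ x ^ 2) ρ)
    (hα : Integrable (fun x ↦ x ^ 2) α) : smoothEntropy ρ ≤ smoothEntropy (ρ.conv α) := by
  set ν := ρ.conv (gaussianReal 0 1) with hν
  have hρα := integrable_sq_conv hρ hα
  have mp : MeasurePreserving (fun p : ℝ × ℝ ↦ p.1 + p.2) (ν.prod α)
      ((ρ.conv α).conv (gaussianReal 0 1)) := by
    rw [conv_right_comm]; exact measurePreserving_add_conv ν α
  have i1 : Integrable (fun p : ℝ × ℝ ↦ logDensity (ρ.conv α) (p.1 + p.2)) (ν.prod α) :=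
    mp.integrable_comp_of_integrable (integrable_logDensity_conv hρα hρα)
  have i2 : Integrable (fun p : ℝ × ℝ ↦ logDensity ρ p.1) (ν.prod α) :=
    (integrable_logDensity_conv hρ hρ).comp_fst α
  have e1 : ∫ p, logDensity (ρ.conv α) (p.1 + p.2) ∂(ν.prod α) = - smoothEntropy (ρ.conv α) := by
    rw [smoothEntropy, neg_neg, ← mp.map_eq, integral_map (by fun_prop) (by fun_prop)]
  have e2 : ∫ p, logDensity ρ p.1 ∂(ν.prod α) = - smoothEntropy ρ := by
    rw [smoothEntropy, neg_neg, integral_fun_fst]; simp [hν]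
  have := integral_le_of_lintegral_exp_le (i1.sub i2) zero_le_one (by
    simp only [Pi.sub_apply, sub_eq_add_neg, Real.exp_add, ENNReal.ofReal_mul (Real.exp_pos _).le,
      ofReal_exp_logDensity, ofReal_exp_neg_logDensity]
    rw [lintegral_prod_symm' _ (by fun_prop)]
    calc _ = ∫⁻ a, 1 ∂α := by
          refine lintegral_congr fun a ↦ ?_
          rw [lintegral_conv_gaussianReal _ (by fun_prop), ← lintegral_smoothDensity (ρ.conv α),
            ← lintegral_add_right_eq_self (smoothDensity (ρ.conv α)) a]
          refine lintegral_congr fun y ↦ ?_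
          rw [mul_left_comm, ENNReal.mul_inv_cancel (smoothDensity_pos ρ y).ne'
            (smoothDensity_ne_top ρ y), mul_one]
      _ ≤ _ := by simp)
  simp only [Pi.sub_apply] at this
  rw [integral_sub i1 i2, e1, e2] at this
  linarith

/-- Submodularity of the entropy of sums of independent random variables. -/
lemma smoothEntropy_submodular (hρ : Integrable (fun x ↦ x ^ 2) ρ)
    (hα : Integrable (fun x ↦ x ^ 2) α) (hβ : Integrable (fun x ↦ x ^ 2) β) :
    smoothEntropy (ρ.conv (α.conv β)) + smoothEntropy ρ ≤
      smoothEntropy (ρ.conv α) + smoothEntropy (ρ.conv β) := by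
  set ν := ρ.conv (gaussianReal 0 1) with hν
  have hρα := integrable_sq_conv hρ hα
  have hρβ := integrable_sq_conv hρ hβ
  have hραβ := integrable_sq_conv hρ (integrable_sq_conv hα hβ)
  have mpα : MeasurePreserving (fun p : ℝ × ℝ × ℝ ↦ p.1 + p.2.1) (ν.prod (α.prod β))
      ((ρ.conv α).conv (gaussianReal 0 1)) := by
    rw [conv_right_comm]
    exact (measurePreserving_add_conv ν α).comp ((MeasurePreserving.id ν).prod
      measurePreserving_fst)
  have mpβ : MeasurePreserving (fun p : ℝ × ℝ × ℝ ↦ p.1 + p.2.2) (ν.prod (α.prod β))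
      ((ρ.conv β).conv (gaussianReal 0 1)) := by
    rw [conv_right_comm]
    exact (measurePreserving_add_conv ν β).comp ((MeasurePreserving.id ν).prod
      measurePreserving_snd)
  have mpαβ : MeasurePreserving (fun p : ℝ × ℝ × ℝ ↦ p.1 + (p.2.1 + p.2.2)) (ν.prod (α.prod β))
      ((ρ.conv (α.conv β)).conv (gaussianReal 0 1)) := by
    rw [conv_right_comm]
    exact (measurePreserving_add_conv ν (α.conv β)).comp ((MeasurePreserving.id ν).prod
      (measurePreserving_add_conv α β))
  have iα : Integrable (fun p : ℝ × ℝ × ℝ ↦ logDensity (ρ.conv α) (p.1 + p.2.1))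
    (ν.prod (α.prod β)) := mpα.integrable_comp_of_integrable (integrable_logDensity_conv hρα hρα)
  have iβ : Integrable (fun p : ℝ × ℝ × ℝ ↦ logDensity (ρ.conv β) (p.1 + p.2.2))
    (ν.prod (α.prod β)) := mpβ.integrable_comp_of_integrable (integrable_logDensity_conv hρβ hρβ)
  have iαβ : Integrable (fun p : ℝ × ℝ × ℝ ↦ logDensity (ρ.conv (α.conv β))
    (p.1 + (p.2.1 + p.2.2))) (ν.prod (α.prod β)) :=
    mpαβ.integrable_comp_of_integrable (integrable_logDensity_conv hραβ hραβ)
  have i0 : Integrable (fun p : ℝ × ℝ × ℝ ↦ logDensity ρ p.1) (ν.prod (α.prod β)) :=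
    (integrable_logDensity_conv hρ hρ).comp_fst _
  have eα : ∫ p, logDensity (ρ.conv α) (p.1 + p.2.1) ∂(ν.prod (α.prod β)) =
      -smoothEntropy (ρ.conv α) := by
    rw [smoothEntropy, neg_neg, ← mpα.map_eq, integral_map (by fun_prop) (by fun_prop)]
  have eβ : ∫ p, logDensity (ρ.conv β) (p.1 + p.2.2) ∂(ν.prod (α.prod β)) =
      -smoothEntropy (ρ.conv β) := by
    rw [smoothEntropy, neg_neg, ← mpβ.map_eq, integral_map (by fun_prop) (by fun_prop)]
  have eαβ : ∫ p, logDensity (ρ.conv (α.conv β)) (p.1 + (p.2.1 + p.2.2)) ∂(ν.prod (α.prod β)) =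
      -smoothEntropy (ρ.conv (α.conv β)) := by
    rw [smoothEntropy, neg_neg, ← mpαβ.map_eq, integral_map (by fun_prop) (by fun_prop)]
  have e0 : ∫ p, logDensity ρ p.1 ∂(ν.prod (α.prod β)) = -smoothEntropy ρ := by
    rw [smoothEntropy, neg_neg, integral_fun_fst]; simp [hν]
  -- The likelihood ratio is `p_{ρ*α}(y+a) p_{ρ*β}(y+b) / (p_{ρ*α*β}(y+a+b) p_ρ(y))`. Substitute `s
  -- = y + a + b`: integrating `p_{ρ*α}(s-b)` over `b` and `p_{ρ*β}(s-a)` over `a` gives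
  -- `p_{ρ*α*β}(s)` twice, and one copy cancels. The mean is 1.
  have := integral_le_of_lintegral_exp_le ((iα.add iβ).sub (iαβ.add i0)) zero_le_one (by
    simp only [Pi.sub_apply, Pi.add_apply, sub_eq_add_neg, neg_add,
      Real.exp_add,
      ENNReal.ofReal_mul (Real.exp_pos _).le, ENNReal.ofReal_mul (mul_pos (Real.exp_pos _)
      (Real.exp_pos _)).le,
      ofReal_exp_logDensity, ofReal_exp_neg_logDensity]
    rw [lintegral_prod_symm' _ (by fun_prop)]
    calc _ = ∫⁻ q, (∫⁻ s, (smoothDensity (ρ.conv (α.conv β)) s)⁻¹ *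
              (smoothDensity (ρ.conv α) (s - q.2) * smoothDensity (ρ.conv β) (s - q.1)))
                ∂(α.prod β) := by
          refine lintegral_congr fun q ↦ ?_
          rw [lintegral_conv_gaussianReal _ (by fun_prop),
            ← lintegral_add_right_eq_self (fun s ↦
              (smoothDensity (ρ.conv (α.conv β)) s)⁻¹ * (smoothDensity (ρ.conv α) (s - q.2) *
                smoothDensity (ρ.conv β) (s - q.1))) (q.1 + q.2)]
          refine lintegral_congr fun y ↦ ?_
          rw [show y + (q.1 + q.2) - q.2 = y + q.1 by ring,
            show y + (q.1 + q.2) - q.1 = y + q.2 by ring]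
          calc _ = (smoothDensity ρ y * (smoothDensity ρ y)⁻¹) *
              ((smoothDensity (ρ.conv (α.conv β)) (y + (q.1 + q.2)))⁻¹ *
                (smoothDensity (ρ.conv α) (y + q.1) * smoothDensity (ρ.conv β) (y + q.2))) := by
                ring
            _ = _ := by
              rw [ENNReal.mul_inv_cancel (smoothDensity_pos ρ y).ne'
                (smoothDensity_ne_top ρ y), one_mul]
      _ = ∫⁻ s, smoothDensity (ρ.conv (α.conv β)) s := by
          rw [lintegral_lintegral_swap (Measurable.aemeasurable (by fun_prop))]
          refine lintegral_congr fun s ↦ ?_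
          rw [lintegral_const_mul _ (by fun_prop), lintegral_prod_symm' _ (by fun_prop)]
          simp_rw [lintegral_const_mul _ (show Measurable fun x ↦ smoothDensity (ρ.conv β) (s - x)
            by fun_prop)]
          rw [← smoothDensity_conv, lintegral_mul_const _ (by fun_prop), ← smoothDensity_conv,
            conv_right_comm ρ β α, Measure.conv_assoc, ← mul_assoc,
            ENNReal.inv_mul_cancel (smoothDensity_pos _ s).ne' (smoothDensity_ne_top _ s), one_mul]
      _ ≤ _ := by simp [lintegral_smoothDensity])
  rw [integral_sub' (iα.add iβ) (iαβ.add i0), integral_add' iα iβ, integral_add' iαβ i0] at this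
  rw [eα, eβ, eαβ, e0] at this
  linarith

/-- Data processing for the relative entropy, followed by its bound by the `χ²`-divergence. -/
lemma integral_logDensity_conv_sub_le (hρ : Integrable (fun x ↦ x ^ 2) ρ)
    (hα : Integrable (fun x ↦ x ^ 2) α) {C : ℝ} (hC : 0 ≤ C)
    (h : ∫⁻ y, smoothDensity α y * (gaussianPDF 0 1 y)⁻¹ ∂(α.conv (gaussianReal 0 1)) ≤
      ENNReal.ofReal C) :
    ∫ y, logDensity (ρ.conv α) y ∂((ρ.conv α).conv (gaussianReal 0 1)) -
      ∫ y, logDensity ρ y ∂((ρ.conv α).conv (gaussianReal 0 1)) ≤ C - 1 := by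
  set ν := α.conv (gaussianReal 0 1) with hν
  have hρα := integrable_sq_conv hρ hα
  -- The standard Gaussian is the smoothing of `dirac 0`, so the log-density lemmas apply to it as
  -- well.
  have hδ : Integrable (fun x : ℝ ↦ x ^ 2) (Measure.dirac 0) := integrable_dirac (by simp)
  have hφ (y : ℝ) : smoothDensity (Measure.dirac 0) y = gaussianPDF 0 1 y := by
    simp [smoothDensity]
  have mp : MeasurePreserving (fun p : ℝ × ℝ ↦ p.1 + p.2) (ρ.prod ν)
      ((ρ.conv α).conv (gaussianReal 0 1)) := by
    rw [Measure.conv_assoc]; exact measurePreserving_add_conv ρ ν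
  have i1 : Integrable (fun p : ℝ × ℝ ↦ logDensity (ρ.conv α) (p.1 + p.2)) (ρ.prod ν) :=
    mp.integrable_comp_of_integrable (integrable_logDensity_conv hρα hρα)
  have i2 : Integrable (fun p : ℝ × ℝ ↦ logDensity ρ (p.1 + p.2)) (ρ.prod ν) :=
    mp.integrable_comp_of_integrable (integrable_logDensity_conv hρ hρα)
  have i3' := integrable_logDensity_conv hα hα
  have i4' := integrable_logDensity_conv hδ hα
  have i3 : Integrable (fun p : ℝ × ℝ ↦ logDensity α p.2) (ρ.prod ν) := i3'.comp_snd ρ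
  have i4 : Integrable (fun p : ℝ × ℝ ↦ logDensity (Measure.dirac 0) p.2) (ρ.prod ν) :=
    i4'.comp_snd ρ
  -- Data processing: `p_{ρ*α}(x+y) φ(y) / (p_ρ(x+y) p_α(y))` has mean at most 1 when `x ∼ ρ` and
  -- `y` has density `p_α`.
  have key := integral_le_of_lintegral_exp_le ((i1.add i4).sub (i2.add i3)) zero_le_one (by
    simp only [Pi.sub_apply, Pi.add_apply, sub_eq_add_neg, neg_add, Real.exp_add,
      ENNReal.ofReal_mul (Real.exp_pos _).le, ENNReal.ofReal_mul (mul_pos (Real.exp_pos _)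
      (Real.exp_pos _)).le,
      ofReal_exp_logDensity, ofReal_exp_neg_logDensity]
    rw [lintegral_prod _ (Measurable.aemeasurable (by fun_prop))]
    calc _ = ∫⁻ x, (∫⁻ s, smoothDensity (ρ.conv α) s * (smoothDensity ρ s)⁻¹ *
            gaussianPDF 0 1 (s - x)) ∂ρ := by
          refine lintegral_congr fun x ↦ ?_
          rw [hν, lintegral_conv_gaussianReal _ (by fun_prop),
            ← lintegral_add_right_eq_self (fun s ↦ smoothDensity (ρ.conv α) s *
              (smoothDensity ρ s)⁻¹ * gaussianPDF 0 1 (s - x)) x]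
          refine lintegral_congr fun y ↦ ?_
          rw [add_sub_cancel_right, hφ, add_comm x y]
          calc _ = (smoothDensity α y * (smoothDensity α y)⁻¹) *
              (smoothDensity (ρ.conv α) (y + x) * (smoothDensity ρ (y + x))⁻¹ *
                gaussianPDF 0 1 y) := by ring
            _ = _ := by
              rw [ENNReal.mul_inv_cancel (smoothDensity_pos α y).ne'
                (smoothDensity_ne_top α y), one_mul]
      _ = ∫⁻ s, smoothDensity (ρ.conv α) s := lintegral_lintegral_ratio_mul_gaussianPDF _ _
      _ ≤ _ := by simp [lintegral_smoothDensity])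
  -- The exponential inequality for `log (p_α / φ)` under `p_α` bounds relative entropy by
  -- `χ²`-divergence.
  have chi := integral_le_of_lintegral_exp_le (i3'.sub i4') hC (by
    simpa only [Pi.sub_apply, sub_eq_add_neg, Real.exp_add,
      ENNReal.ofReal_mul (Real.exp_pos _).le, ofReal_exp_logDensity, ofReal_exp_neg_logDensity, hφ]
      using h)
  rw [integral_sub' (i1.add i4) (i2.add i3), integral_add' i1 i4, integral_add' i2 i3,
    integral_fun_snd (logDensity α), integral_fun_snd (logDensity (Measure.dirac 0)),
    probReal_univ, one_smul, one_smul] at key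
  rw [integral_sub' i3' i4'] at chi
  rw [← mp.map_eq, integral_map (by fun_prop) (by fun_prop),
    integral_map (by fun_prop) (by fun_prop)]
  linarith

end

/-! ### The objective in real terms and the bound for Gaussian second inputs -/

lemma integrable_sq_of_secondMoment_ne_top {μ : Measure ℝ} (h : secondMoment μ ≠ ∞) :
    Integrable (fun x ↦ x ^ 2) μ := by
  refine ⟨by fun_prop, ?_⟩
  rw [hasFiniteIntegral_iff_ofReal (ae_of_all _ fun x ↦ sq_nonneg x)]
  exact lt_top_iff_ne_top.2 h

lemma secondMoment_eq_ofReal {μ : Measure ℝ} (h : Integrable (fun x ↦ x ^ 2) μ) :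
    secondMoment μ = ENNReal.ofReal (∫ x, x ^ 2 ∂μ) :=
  (ofReal_integral_eq_lintegral_ofReal h (ae_of_all _ fun x ↦ sq_nonneg x)).symm

/-- The objective with unit weight and unit first noise is a combination of real entropies. -/
lemma zObjective_eq {N S : ℝ≥0} {μ κ : Measure ℝ} [IsProbabilityMeasure μ]
    [IsProbabilityMeasure κ] (hμ : Integrable (fun x ↦ x ^ 2) μ)
    (hκ : Integrable (fun x ↦ x ^ 2) κ) :
    zObjective 1 1 N S (μ, κ) =
      ((smoothEntropy (μ.conv (κ.conv (gaussianReal 0 N))) + smoothEntropy μ -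
        2 * smoothEntropy (μ.conv (gaussianReal 0 N)) - S * ∫ x, x ^ 2 ∂μ : ℝ) : EReal) := by
  have hN := integrable_sq_gaussianReal 0 N
  -- Moving the unit noise to the end shows each output law as a Gaussian smoothing.
  have e1 : μ.conv (κ.conv ((gaussianReal 0 1).conv (gaussianReal 0 N))) =
      (μ.conv (κ.conv (gaussianReal 0 N))).conv (gaussianReal 0 1) := by
    rw [Measure.conv_comm (gaussianReal 0 1), ← Measure.conv_assoc κ, ← Measure.conv_assoc μ]
  have e2 : μ.conv ((gaussianReal 0 1).conv (gaussianReal 0 N)) =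
      (μ.conv (gaussianReal 0 N)).conv (gaussianReal 0 1) := by
    rw [Measure.conv_comm (gaussianReal 0 1), ← Measure.conv_assoc μ]
  have e3 : ((1 + (1 : ℝ≥0) : ℝ) : EReal) = ((2 : ℝ) : EReal) := by norm_num
  simp only [zObjective]
  rw [e1, e2, differentialEntropy_conv_gaussianReal _
    (integrable_sq_conv hμ (integrable_sq_conv hκ hN)),
    differentialEntropy_conv_gaussianReal _ hμ,
    differentialEntropy_conv_gaussianReal _ (integrable_sq_conv hμ hN),
    secondMoment_eq_ofReal hμ, EReal.coe_ennreal_ofReal,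
    max_eq_left (integral_nonneg fun x ↦ sq_nonneg x), e3]
  norm_cast
  simp

/-- For a Gaussian law of the second input the objective is not positive. -/
lemma zObjective_gaussian_le {N S : ℝ≥0} (hS : 0 < S) {μ κ : Measure ℝ}
    [IsProbabilityMeasure μ] [IsGaussian κ] (hκ : secondMoment κ ≤ N) :
    zObjective 1 1 N S (μ, κ) ≤ 0 := by
  by_cases hμ : secondMoment μ = ∞
  · simp only [zObjective, hμ, EReal.coe_ennreal_top]
    rw [EReal.coe_mul_top_of_pos (by exact_mod_cast hS), EReal.sub_top]
    exact bot_le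
  replace hμ := integrable_sq_of_secondMoment_ne_top hμ
  have hκ2 : Integrable (fun x ↦ x ^ 2) κ :=
    integrable_sq_of_secondMoment_ne_top (ne_top_of_le_ne_top ENNReal.coe_ne_top hκ)
  rw [zObjective_eq hμ hκ2]
  obtain ⟨m, v, rfl⟩ : ∃ m v, κ = gaussianReal m v :=
    ⟨_, _, IsGaussian.eq_gaussianReal κ inferInstance⟩
  have hv : v ≤ N := by
    rw [secondMoment_eq_ofReal hκ2, ← ENNReal.ofReal_coe_nnreal,
      ENNReal.ofReal_le_ofReal_iff N.coe_nonneg] at hκ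
    have h1 := variance_le_expectation_sq (μ := gaussianReal m v) (X := id) (by fun_prop)
    rw [variance_id_gaussianReal] at h1
    exact_mod_cast h1.trans (by simpa using hκ)
  have hN := integrable_sq_gaussianReal 0 N
  have h1 := smoothEntropy_submodular hμ hκ2 hN
  -- The law `N(-m, N - v)` completes `N(m, v)` to the noise law `N(0, N)`; this is where
  -- Gaussianity of `κ` is used.
  have h2 := smoothEntropy_le_smoothEntropy_conv (integrable_sq_conv hμ hκ2)
    (integrable_sq_gaussianReal (-m) (N - v))
  rw [Measure.conv_assoc, gaussianReal_conv_gaussianReal, add_neg_cancel,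
    add_tsub_cancel_of_le hv] at h2
  have h3 : 0 ≤ (S : ℝ) * ∫ x, x ^ 2 ∂μ :=
    mul_nonneg S.coe_nonneg (integral_nonneg fun x ↦ sq_nonneg x)
  norm_cast
  linarith

/-! ### Third-order Taylor expansion under a small perturbation -/

lemma abs_le_mul_pow_succ_of_hasDerivAt {g g' : ℝ → ℝ} {M : ℝ} {n : ℕ} (h0 : g 0 = 0)
    (hg : ∀ t, HasDerivAt g (g' t) t) (hM : ∀ t, |g' t| ≤ M * |t| ^ n) (t : ℝ) :
    |g t| ≤ M * |t| ^ (n + 1) := by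
  have hM0 : 0 ≤ M := by simpa using (abs_nonneg _).trans (hM 1)
  have := (convex_uIcc 0 t).norm_image_sub_le_of_norm_hasDerivWithin_le (f := g) (f' := g')
    (C := M * |t| ^ n) (fun s _ ↦ (hg s).hasDerivWithinAt) (fun s hs ↦ by
      refine (hM s).trans ?_
      have : |s| ≤ |t| := by simpa using Set.abs_sub_left_of_mem_uIcc hs
      gcongr) Set.left_mem_uIcc Set.right_mem_uIcc
  rw [h0, sub_zero, sub_zero, Real.norm_eq_abs, Real.norm_eq_abs] at this
  rw [pow_succ, ← mul_assoc]
  exact this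

/-- Four applications of the mean value inequality, from the third derivative down to `f`. The sharp
factor `1/24` is given up, as only the order of the remainder matters. -/
lemma abs_sub_taylor_three_le {f f1 f2 f3 f4 : ℝ → ℝ} {M : ℝ}
    (h1 : ∀ t, HasDerivAt f (f1 t) t) (h2 : ∀ t, HasDerivAt f1 (f2 t) t)
    (h3 : ∀ t, HasDerivAt f2 (f3 t) t) (h4 : ∀ t, HasDerivAt f3 (f4 t) t)
    (hM : ∀ t, |f4 t| ≤ M) (y v : ℝ) :
    |f (y + v) - (f y + v * f1 y + v ^ 2 / 2 * f2 y + v ^ 3 / 6 * f3 y)| ≤ M * v ^ 4 := by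
  have d {F F' : ℝ → ℝ} (h : ∀ t, HasDerivAt F (F' t) t) (t : ℝ) :
      HasDerivAt (fun t ↦ F (y + t)) (F' (y + t)) t := (h (y + t)).comp_const_add y t
  have g3 := abs_le_mul_pow_succ_of_hasDerivAt (g := fun t ↦ f3 (y + t) - f3 y)
    (g' := fun t ↦ f4 (y + t)) (M := M) (n := 0) (by simp) (fun t ↦ (d h4 t).sub_const _)
    (fun t ↦ by simpa using hM _)
  have g2 := abs_le_mul_pow_succ_of_hasDerivAt (g := fun t ↦ f2 (y + t) - (f2 y + t * f3 y))
    (by simp) (fun t ↦ by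
      exact ((d h3 t).sub (((hasDerivAt_id t).mul_const (f3 y)).const_add (f2 y))).congr_deriv
        (by simp)) g3
  have g1 := abs_le_mul_pow_succ_of_hasDerivAt
    (g := fun t ↦ f1 (y + t) - (f1 y + t * f2 y + t ^ 2 / 2 * f3 y))
    (by simp) (fun t ↦ by
      exact ((d h2 t).sub ((((hasDerivAt_id t).mul_const (f2 y)).const_add (f1 y)).add
        (((hasDerivAt_pow 2 t).div_const 2).mul_const (f3 y)))).congr_deriv (by simp)) g2
  have g0 := abs_le_mul_pow_succ_of_hasDerivAt
    (g := fun t ↦ f (y + t) - (f y + t * f1 y + t ^ 2 / 2 * f2 y + t ^ 3 / 6 * f3 y))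
    (by simp) (fun t ↦ by
      exact ((d h1 t).sub (((((hasDerivAt_id t).mul_const (f1 y)).const_add (f y)).add
        (((hasDerivAt_pow 2 t).div_const 2).mul_const (f2 y))).add
        (((hasDerivAt_pow 3 t).div_const 6).mul_const (f3 y)))).congr_deriv (by push_cast; ring)) g1 v
  have e : |v| ^ 4 = v ^ 4 := by rw [← abs_pow, abs_of_nonneg (by positivity)]
  rw [← e]
  exact g0

lemma integrable_pow_four_of_integrable_exp_sq {κ : Measure ℝ} {c : ℝ} (hc : 0 < c)
    (h : Integrable (fun v ↦ Real.exp (c * v ^ 2)) κ) : Integrable (fun v ↦ v ^ 4) κ := by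
  refine Integrable.mono' (h.const_mul (2 / c ^ 2)) (by fun_prop) (ae_of_all _ fun v ↦ ?_)
  have := Real.pow_div_factorial_le_exp (c * v ^ 2) (by positivity) 2
  simp only [Nat.factorial, norm_pow, Real.norm_eq_abs] at *
  rw [← abs_pow, abs_of_nonneg (by positivity), div_mul_eq_mul_div, le_div_iff₀ (by positivity)]
  norm_num at this
  linarith

section
variable {κ : Measure ℝ} [IsProbabilityMeasure κ] {c : ℝ}

lemma integrable_pow_of_integrable_pow_four (h : Integrable (fun v ↦ v ^ 4) κ) {k : ℕ}
    (hk : k ≤ 4) : Integrable (fun v ↦ v ^ k) κ := by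
  refine Integrable.mono' ((integrable_const (1 : ℝ)).add h) (by fun_prop) (ae_of_all _ fun v ↦ ?_)
  simp only [norm_pow, Real.norm_eq_abs, Pi.add_apply]
  have e : |v| ^ 4 = v ^ 4 := by rw [← abs_pow, abs_of_nonneg (by positivity)]
  rw [← e]
  rcases le_total |v| 1 with h1 | h1
  · have := pow_le_one₀ (n := k) (abs_nonneg v) h1
    have := pow_nonneg (abs_nonneg v) 4
    linarith
  · have := pow_le_pow_right₀ h1 hk
    linarith

/-- Integrate the pointwise Taylor bound over `P.prod κ`; by independence each term factors into a
moment of `κ` and a mean of a derivative. -/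
lemma abs_integral_conv_map_sub_taylor_le {P : Measure ℝ} [IsProbabilityMeasure P]
    {f f1 f2 f3 f4 : ℝ → ℝ} {M : ℝ}
    (h1 : ∀ t, HasDerivAt f (f1 t) t) (h2 : ∀ t, HasDerivAt f1 (f2 t) t)
    (h3 : ∀ t, HasDerivAt f2 (f3 t) t) (h4 : ∀ t, HasDerivAt f3 (f4 t) t)
    (hM : ∀ t, |f4 t| ≤ M) (i0 : Integrable f P) (i1 : Integrable f1 P) (i2 : Integrable f2 P)
    (i3 : Integrable f3 P) (hκ : Integrable (fun v ↦ v ^ 4) κ) (ε : ℝ)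
    (hf : Integrable f (P.conv (κ.map (ε * ·)))) :
    |∫ y, f y ∂(P.conv (κ.map (ε * ·))) - (∫ y, f y ∂P + ε * (∫ v, v ∂κ) * (∫ y, f1 y ∂P) +
      ε ^ 2 / 2 * (∫ v, v ^ 2 ∂κ) * (∫ y, f2 y ∂P) +
      ε ^ 3 / 6 * (∫ v, v ^ 3 ∂κ) * (∫ y, f3 y ∂P))| ≤ ε ^ 4 * (M * ∫ v, v ^ 4 ∂κ) := by
  have k1 : Integrable (fun v ↦ v) κ := by
    simpa using integrable_pow_of_integrable_pow_four hκ (k := 1) (by norm_num)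
  have k2 := integrable_pow_of_integrable_pow_four hκ (k := 2) (by norm_num)
  have k3 := integrable_pow_of_integrable_pow_four hκ (k := 3) (by norm_num)
  have mp : MeasurePreserving (fun p : ℝ × ℝ ↦ p.1 + ε * p.2) (P.prod κ)
      (P.conv (κ.map (ε * ·))) :=
    (measurePreserving_add_conv P (κ.map (ε * ·))).comp ((MeasurePreserving.id P).prod
      ⟨by fun_prop, rfl⟩)
  have hfm : Measurable f := (continuous_iff_continuousAt.2 fun t ↦ (h1 t).continuousAt).measurable
  have j : Integrable (fun p : ℝ × ℝ ↦ f (p.1 + ε * p.2)) (P.prod κ) :=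
    mp.integrable_comp_of_integrable hf
  have j0 : Integrable (fun p : ℝ × ℝ ↦ f p.1) (P.prod κ) := i0.comp_fst κ
  have j1 : Integrable (fun p : ℝ × ℝ ↦ ε * (f1 p.1 * p.2)) (P.prod κ) :=
    (i1.mul_prod k1).const_mul ε
  have j2 : Integrable (fun p : ℝ × ℝ ↦ ε ^ 2 / 2 * (f2 p.1 * p.2 ^ 2)) (P.prod κ) :=
    (i2.mul_prod k2).const_mul _
  have j3 : Integrable (fun p : ℝ × ℝ ↦ ε ^ 3 / 6 * (f3 p.1 * p.2 ^ 3)) (P.prod κ) :=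
    (i3.mul_prod k3).const_mul _
  have e : ∫ y, f y ∂(P.conv (κ.map (ε * ·))) = ∫ p, f (p.1 + ε * p.2) ∂(P.prod κ) := by
    rw [← mp.map_eq, integral_map (by fun_prop) (by fun_prop)]
  have e0 : ∫ p, f p.1 ∂(P.prod κ) = ∫ y, f y ∂P := by rw [integral_fun_fst]; simp
  have e1 : ∫ p, ε * (f1 p.1 * p.2) ∂(P.prod κ) = ε * (∫ v, v ∂κ) * (∫ y, f1 y ∂P) := by
    rw [integral_const_mul, integral_prod_mul f1 (fun v ↦ v)]; ring
  have e2 : ∫ p, ε ^ 2 / 2 * (f2 p.1 * p.2 ^ 2) ∂(P.prod κ) =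
      ε ^ 2 / 2 * (∫ v, v ^ 2 ∂κ) * (∫ y, f2 y ∂P) := by
    rw [integral_const_mul, integral_prod_mul f2 (fun v ↦ v ^ 2)]; ring
  have e3 : ∫ p, ε ^ 3 / 6 * (f3 p.1 * p.2 ^ 3) ∂(P.prod κ) =
      ε ^ 3 / 6 * (∫ v, v ^ 3 ∂κ) * (∫ y, f3 y ∂P) := by
    rw [integral_const_mul, integral_prod_mul f3 (fun v ↦ v ^ 3)]; ring
  rw [e, ← e0, ← e1, ← e2, ← e3, ← integral_add' j0 j1, ← integral_add' (j0.add j1) j2,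
    ← integral_add' ((j0.add j1).add j2) j3, ← integral_sub' j (((j0.add j1).add j2).add j3)]
  have r : ∫ p : ℝ × ℝ, ε ^ 4 * (M * p.2 ^ 4) ∂(P.prod κ) = ε ^ 4 * (M * ∫ v, v ^ 4 ∂κ) := by
    rw [integral_const_mul, integral_const_mul, integral_fun_snd (fun v ↦ v ^ 4)]; simp
  rw [← r]
  refine (abs_integral_le_integral_abs).trans (integral_mono_of_nonneg
    (ae_of_all _ fun p ↦ abs_nonneg _) (((hκ.comp_snd P).const_mul M).const_mul (ε ^ 4))
    (ae_of_all _ fun p ↦ ?_))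
  have := abs_sub_taylor_three_le h1 h2 h3 h4 hM p.1 (ε * p.2)
  simp only [Pi.add_apply, Pi.sub_apply]
  refine le_trans (le_of_eq ?_) (this.trans (le_of_eq ?_))
  · congr 1; ring
  · ring

/-! ### The `χ²`-divergence of a small centred perturbation -/

lemma smoothDensity_mul_inv_gaussianPDF (α : Measure ℝ) (y : ℝ) :
    smoothDensity α y * (gaussianPDF 0 1 y)⁻¹ =
      ∫⁻ v, ENNReal.ofReal (Real.exp (v * y - v ^ 2 / 2)) ∂α := by
  rw [smoothDensity, ← lintegral_mul_const' _ _
    (ENNReal.inv_ne_top.2 (gaussianPDF_pos 0 one_ne_zero y).ne')]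
  refine lintegral_congr fun v ↦ ?_
  rw [gaussianPDF_zero_one, gaussianPDF_zero_one, ← ENNReal.ofReal_inv_of_pos (by positivity),
    ← ENNReal.ofReal_mul (by positivity)]
  congr 1
  rw [mul_inv, ← Real.exp_neg, mul_mul_mul_comm, mul_inv_cancel₀ (by positivity), one_mul,
    ← Real.exp_add]
  congr 1
  ring

lemma lintegral_exp_mul_gaussianReal (t : ℝ) :
    ∫⁻ z, ENNReal.ofReal (Real.exp (t * z)) ∂(gaussianReal 0 1) =
      ENNReal.ofReal (Real.exp (t ^ 2 / 2)) := by
  rw [← ofReal_integral_eq_lintegral_ofReal (integrable_exp_mul_gaussianReal t)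
    (ae_of_all _ fun z ↦ (Real.exp_pos _).le)]
  have := congrFun (mgf_fun_id_gaussianReal (μ := 0) (v := 1)) t
  rw [mgf] at this
  rw [this]
  simp

/-- The `χ²`-integral of a Gaussian smoothing against the standard Gaussian law. -/
lemma lintegral_smoothDensity_mul_inv_gaussianPDF (α : Measure ℝ) [IsProbabilityMeasure α] :
    ∫⁻ y, smoothDensity α y * (gaussianPDF 0 1 y)⁻¹ ∂(α.conv (gaussianReal 0 1)) =
      ∫⁻ p, ENNReal.ofReal (Real.exp (p.1 * p.2)) ∂(α.prod α) := by
  simp_rw [smoothDensity_mul_inv_gaussianPDF]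
  rw [lintegral_lintegral_swap (Measurable.aemeasurable (by fun_prop)),
    lintegral_prod _ (Measurable.aemeasurable (by fun_prop))]
  refine lintegral_congr fun v ↦ ?_
  rw [Measure.lintegral_conv (by fun_prop)]
  refine lintegral_congr fun x ↦ ?_
  have h (z : ℝ) : ENNReal.ofReal (Real.exp (v * (x + z) - v ^ 2 / 2)) =
      ENNReal.ofReal (Real.exp (v * x - v ^ 2 / 2)) * ENNReal.ofReal (Real.exp (v * z)) := by
    rw [← ENNReal.ofReal_mul (Real.exp_pos _).le, ← Real.exp_add]
    ring_nf
  simp_rw [h]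
  -- The Gaussian moment generating function gives `exp (v² / 2)`, which cancels the normalisation
  -- and leaves `exp (v x)`.
  rw [lintegral_const_mul _ (by fun_prop), lintegral_exp_mul_gaussianReal,
    ← ENNReal.ofReal_mul (Real.exp_pos _).le, ← Real.exp_add]
  ring_nf

lemma exp_le_one_add_add_sq_mul_exp_abs (x : ℝ) :
    Real.exp x ≤ 1 + x + x ^ 2 * Real.exp |x| := by
  have h1 : Real.exp x - 1 ≤ x * Real.exp x := by
    have := mul_le_mul_of_nonneg_right (Real.add_one_le_exp (-x)) (Real.exp_pos x).le
    rw [← Real.exp_add, neg_add_cancel, Real.exp_zero] at this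
    linarith
  have h2 := Real.add_one_le_exp x
  rcases le_total 0 x with hx | hx
  · rw [abs_of_nonneg hx]
    nlinarith [mul_le_mul_of_nonneg_left h1 hx]
  · have h3 : 1 ≤ Real.exp |x| := Real.one_le_exp (abs_nonneg x)
    nlinarith [mul_le_mul_of_nonneg_left h3 (sq_nonneg x)]

/-- The `χ²`-integral of a centred law scaled by `ε` is `1 + O(ε⁴)`. -/
lemma lintegral_exp_mul_map_le (hc : 0 < c)
    (h : Integrable (fun v ↦ Real.exp (c * v ^ 2)) κ) (hmean : ∫ v, v ∂κ = 0) {ε : ℝ}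
    (hε : ε ^ 2 ≤ c) :
    ∫⁻ p, ENNReal.ofReal (Real.exp (p.1 * p.2)) ∂((κ.map (ε * ·)).prod (κ.map (ε * ·))) ≤
      ENNReal.ofReal (1 + ε ^ 4 * (∫ v, v ^ 2 * Real.exp (c / 2 * v ^ 2) ∂κ) ^ 2) := by
  set w : ℝ → ℝ := fun v ↦ v ^ 2 * Real.exp (c / 2 * v ^ 2) with hw
  have k1 : Integrable (fun v ↦ v) κ := by
    simpa using integrable_pow_of_integrable_pow_four
      (integrable_pow_four_of_integrable_exp_sq hc h) (k := 1) (by norm_num)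
  have iw : Integrable w κ := by
    refine Integrable.mono' (h.const_mul (2 / c)) (by fun_prop) (ae_of_all _ fun v ↦ ?_)
    rw [Real.norm_eq_abs, abs_of_nonneg (by positivity),
      show c * v ^ 2 = c / 2 * v ^ 2 + c / 2 * v ^ 2 by ring, Real.exp_add, ← mul_assoc]
    refine mul_le_mul_of_nonneg_right ?_ (Real.exp_pos _).le
    have := Real.add_one_le_exp (c / 2 * v ^ 2)
    calc v ^ 2 = 2 / c * (c / 2 * v ^ 2) := by field_simp
      _ ≤ _ := by gcongr; linarith
  have j1 : Integrable (fun p : ℝ × ℝ ↦ ε ^ 2 * (p.1 * p.2)) (κ.prod κ) :=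
    (k1.mul_prod k1).const_mul _
  have j2 : Integrable (fun p : ℝ × ℝ ↦ ε ^ 4 * (w p.1 * w p.2)) (κ.prod κ) :=
    (iw.mul_prod iw).const_mul _
  have j0 : Integrable (fun _ : ℝ × ℝ ↦ (1 : ℝ)) (κ.prod κ) := integrable_const _
  -- With `ε² ≤ c` and AM-GM, the exponent in the remainder splits into a sum over the two
  -- coordinates, so the remainder is a product of integrable functions. The `ε²` term later
  -- vanishes because the mean is 0.
  have hle (p : ℝ × ℝ) : Real.exp ((ε * p.1) * (ε * p.2)) ≤
      1 + ε ^ 2 * (p.1 * p.2) + ε ^ 4 * (w p.1 * w p.2) := by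
    have h1 := exp_le_one_add_add_sq_mul_exp_abs ((ε * p.1) * (ε * p.2))
    have h2 : |(ε * p.1) * (ε * p.2)| ≤ c / 2 * p.1 ^ 2 + c / 2 * p.2 ^ 2 := by
      rw [show (ε * p.1) * (ε * p.2) = ε ^ 2 * (p.1 * p.2) by ring, abs_mul,
        abs_of_nonneg (sq_nonneg ε)]
      calc _ ≤ c * |p.1 * p.2| := by gcongr
        _ ≤ c * ((p.1 ^ 2 + p.2 ^ 2) / 2) := by
          gcongr
          rw [abs_le]; constructor <;> nlinarith [sq_nonneg (p.1 + p.2), sq_nonneg (p.1 - p.2)]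
        _ = _ := by ring
    have h3 : ((ε * p.1) * (ε * p.2)) ^ 2 * Real.exp |(ε * p.1) * (ε * p.2)| ≤
        ε ^ 4 * (w p.1 * w p.2) := by
      calc _ ≤ ((ε * p.1) * (ε * p.2)) ^ 2 * Real.exp (c / 2 * p.1 ^ 2 + c / 2 * p.2 ^ 2) := by
            gcongr
        _ = _ := by rw [Real.exp_add, hw]; ring
    linarith
  have hmp : MeasurePreserving (fun p : ℝ × ℝ ↦ (ε * p.1, ε * p.2)) (κ.prod κ)
      ((κ.map (ε * ·)).prod (κ.map (ε * ·))) :=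
    MeasurePreserving.prod ⟨by fun_prop, rfl⟩ ⟨by fun_prop, rfl⟩
  rw [← hmp.map_eq, lintegral_map (by fun_prop) (by fun_prop)]
  calc _ ≤ ∫⁻ p, ENNReal.ofReal (1 + ε ^ 2 * (p.1 * p.2) + ε ^ 4 * (w p.1 * w p.2)) ∂(κ.prod κ) :=
        lintegral_mono fun p ↦ ENNReal.ofReal_le_ofReal (hle p)
    _ = ENNReal.ofReal (∫ p, (1 + ε ^ 2 * (p.1 * p.2) + ε ^ 4 * (w p.1 * w p.2)) ∂(κ.prod κ)) :=
        (ofReal_integral_eq_lintegral_ofReal ((j0.add j1).add j2)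
          (ae_of_all _ fun p ↦ (Real.exp_pos _).le.trans (hle p))).symm
    _ = _ := by
        have e : ∫ p, (1 + ε ^ 2 * (p.1 * p.2) + ε ^ 4 * (w p.1 * w p.2)) ∂(κ.prod κ) =
            ∫ _, 1 ∂(κ.prod κ) + ∫ p, ε ^ 2 * (p.1 * p.2) ∂(κ.prod κ) +
              ∫ p, ε ^ 4 * (w p.1 * w p.2) ∂(κ.prod κ) := by
          rw [← integral_add' j0 j1, ← integral_add' (j0.add j1) j2]; rfl
        rw [e, integral_const_mul,
          integral_const_mul, integral_prod_mul (fun v ↦ v) (fun v ↦ v), integral_prod_mul w w,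
          hmean]
        simp [sq]

end

/-! ### Gaussian moments and the expansion of the entropy gap -/

lemma integral_cube_gaussianReal_zero : ∫ v, v ^ 3 ∂(gaussianReal 0 1) = 0 := by
  have h := gaussianReal_map_neg (μ := 0) (v := 1)
  rw [neg_zero] at h
  have h2 : ∫ v, v ^ 3 ∂(gaussianReal 0 1) = ∫ v, (-v) ^ 3 ∂(gaussianReal 0 1) := by
    conv_lhs => rw [← h]
    rw [integral_map (by fun_prop) (by fun_prop)]
  have h3 : ∫ v, (-v) ^ 3 ∂(gaussianReal 0 1) = -∫ v, v ^ 3 ∂(gaussianReal 0 1) := by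
    rw [← integral_neg]; congr 1; ext v; ring
  linarith

lemma integrable_pow_gaussianReal (m : ℝ) (v : ℝ≥0) (k : ℕ) :
    Integrable (fun x ↦ x ^ k) (gaussianReal m v) := by
  rcases eq_or_ne k 0 with rfl | hk
  · simp
  · have := (memLp_id_gaussianReal (μ := m) (v := v) k).integrable_norm_pow (by simpa using hk)
    refine (integrable_norm_iff (by fun_prop)).1 ?_
    simpa using this

lemma integral_sq_gaussianReal (m : ℝ) : ∫ x, x ^ 2 ∂(gaussianReal m 1) = m ^ 2 + 1 := by
  have := variance_eq_sub (memLp_id_gaussianReal (μ := m) (v := 1) 2)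
  rw [variance_id_gaussianReal] at this
  simp at this
  linarith

lemma integral_cube_gaussianReal (m : ℝ) :
    ∫ x, x ^ 3 ∂(gaussianReal m 1) = m ^ 3 + 3 * m := by
  have h := gaussianReal_map_add_const (μ := 0) (v := 1) m
  rw [zero_add] at h
  have i1 : Integrable (fun x ↦ x) (gaussianReal 0 1) := by
    simpa using integrable_pow_gaussianReal 0 1 1
  have i2 := integrable_pow_gaussianReal 0 1 2
  have i3 := integrable_pow_gaussianReal 0 1 3
  have e : ∫ x, (x + m) ^ 3 ∂(gaussianReal 0 1) =
      ∫ x, x ^ 3 ∂(gaussianReal 0 1) + ∫ x, 3 * m * x ^ 2 ∂(gaussianReal 0 1) +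
        ∫ x, 3 * m ^ 2 * x ∂(gaussianReal 0 1) + ∫ _, m ^ 3 ∂(gaussianReal 0 1) := by
    rw [← integral_add' i3 (i2.const_mul _), ← integral_add' (i3.add (i2.const_mul _))
      (i1.const_mul _), ← integral_add' ((i3.add (i2.const_mul _)).add (i1.const_mul _))
      (integrable_const _)]
    congr 1; ext x; simp only [Pi.add_apply]; ring
  rw [← h, integral_map (by fun_prop) (by fun_prop), e, integral_const_mul, integral_const_mul,
    integral_cube_gaussianReal_zero, integral_sq_gaussianReal, integral_id_gaussianReal]
  simp; ring

/-- Third-order expansion of the entropy gap for a small centred perturbation whose variance is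
twice that of the Gaussian perturbation. -/
lemma exists_entropyGap_ge {ρ κ : Measure ℝ} [IsProbabilityMeasure ρ] [IsProbabilityMeasure κ]
    (hρ : Integrable (fun x ↦ x ^ 2) ρ) {c : ℝ} (hc : 0 < c)
    (hκ : Integrable (fun v ↦ Real.exp (c * v ^ 2)) κ) (hκ1 : ∫ v, v ∂κ = 0)
    (hκ2 : ∫ v, v ^ 2 ∂κ = 2)
    {f1 f2 f3 f4 : ℝ → ℝ} {M : ℝ}
    (h1 : ∀ t, HasDerivAt (logDensity ρ) (f1 t) t) (h2 : ∀ t, HasDerivAt f1 (f2 t) t)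
    (h3 : ∀ t, HasDerivAt f2 (f3 t) t) (h4 : ∀ t, HasDerivAt f3 (f4 t) t)
    (hM : ∀ t, |f4 t| ≤ M)
    (i1 : Integrable f1 (ρ.conv (gaussianReal 0 1)))
    (i2 : Integrable f2 (ρ.conv (gaussianReal 0 1)))
    (i3 : Integrable f3 (ρ.conv (gaussianReal 0 1))) :
    ∃ C, ∀ ε : ℝ, ε ^ 2 ≤ c →
      -(ε ^ 3 / 6 * (∫ v, v ^ 3 ∂κ) * ∫ y, f3 y ∂(ρ.conv (gaussianReal 0 1))) - C * ε ^ 4 ≤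
        smoothEntropy (ρ.conv (κ.map (ε * ·))) + smoothEntropy ρ -
          2 * smoothEntropy (ρ.conv ((gaussianReal 0 1).map (ε * ·))) := by
  set P := ρ.conv (gaussianReal 0 1) with hP
  have hκ4 := integrable_pow_four_of_integrable_exp_sq hc hκ
  have hg4 : Integrable (fun v ↦ v ^ 4) (gaussianReal 0 1) :=
    integrable_pow_gaussianReal 0 1 4
  have hg2 : ∫ v, v ^ 2 ∂(gaussianReal 0 1) = 1 := by simpa using integral_sq_gaussianReal 0
  have hm (τ : Measure ℝ) (hτ : Integrable (fun v ↦ v ^ 2) τ) (ε : ℝ) :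
      Integrable (fun v ↦ v ^ 2) (τ.map (ε * ·)) := by
    rw [integrable_map_measure (by fun_prop) (by fun_prop)]
    simpa [Function.comp_def, mul_pow] using hτ.const_mul (ε ^ 2)
  set K := ∫ v, v ^ 2 * Real.exp (c / 2 * v ^ 2) ∂κ
  set G4 := ∫ v, v ^ 4 ∂(gaussianReal 0 1)
  set K4 := ∫ v, v ^ 4 ∂κ
  -- `K ^ 2` is the `χ²` cost; the other terms are the Taylor remainders for `κ` and for the
  -- Gaussian entropy, which occurs twice.
  refine ⟨K ^ 2 + M * K4 + 2 * (M * G4), fun ε hε ↦ ?_⟩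
  set τ := κ.map (ε * ·) with hτ
  set γ := (gaussianReal 0 1).map (ε * ·) with hγ
  have : IsProbabilityMeasure τ := Measure.isProbabilityMeasure_map (by fun_prop)
  have : IsProbabilityMeasure γ := Measure.isProbabilityMeasure_map (by fun_prop)
  have hτ2 : Integrable (fun v ↦ v ^ 2) τ :=
    hm κ (integrable_pow_of_integrable_pow_four hκ4 (by norm_num)) ε
  have hγ2 : Integrable (fun v ↦ v ^ 2) γ := hm _ (integrable_sq_gaussianReal 0 1) ε
  have eτ : (ρ.conv τ).conv (gaussianReal 0 1) = P.conv τ := conv_right_comm _ _ _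
  have eγ : (ρ.conv γ).conv (gaussianReal 0 1) = P.conv γ := conv_right_comm _ _ _
  have iτ := integrable_logDensity_conv hρ (integrable_sq_conv hρ hτ2)
  have iγ := integrable_logDensity_conv hρ (integrable_sq_conv hρ hγ2)
  have hr := integral_logDensity_conv_sub_le hρ hτ2 (by positivity)
    ((lintegral_smoothDensity_mul_inv_gaussianPDF τ).trans_le
      (lintegral_exp_mul_map_le hc hκ hκ1 hε))
  have hq := smoothEntropy_le_crossEntropy (integrable_sq_conv hρ hγ2) hρ
  have er : smoothEntropy (ρ.conv τ) =
    -∫ y, logDensity (ρ.conv τ) y ∂((ρ.conv τ).conv (gaussianReal 0 1)) := rfl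
  have ep : smoothEntropy ρ = -∫ y, logDensity ρ y ∂P := rfl
  rw [eτ] at iτ hr er
  rw [eγ] at iγ hq
  have i0 := integrable_logDensity_conv hρ hρ
  have tτ := abs_le.1 (abs_integral_conv_map_sub_taylor_le h1 h2 h3 h4 hM i0 i1 i2 i3 hκ4 ε iτ)
  have tγ := abs_le.1 (abs_integral_conv_map_sub_taylor_le h1 h2 h3 h4 hM i0 i1 i2 i3 hg4 ε iγ)
  -- The second-order terms cancel: variance 2 counted once against variance 1 counted twice. The
  -- Gaussian has no cubic term.
  rw [hκ1, hκ2] at tτ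
  rw [hg2, integral_cube_gaussianReal_zero, integral_id_gaussianReal] at tγ
  obtain ⟨-, tτ⟩ := tτ
  obtain ⟨tγ, -⟩ := tγ
  rw [er, ep]
  simp only [← hτ, ← hγ, ← hP] at tτ tγ hr hq ⊢
  linarith

/-! ### Two-point input laws and their moments -/

/-- The mixture of two laws with weights `w` and `1 - w`. -/
noncomputable def mixture (w : ℝ) (μ ν : Measure ℝ) : Measure ℝ :=
  ENNReal.ofReal w • μ + ENNReal.ofReal (1 - w) • ν

section
variable {w : ℝ} {μ ν : Measure ℝ}

lemma isProbabilityMeasure_mixture [IsProbabilityMeasure μ] [IsProbabilityMeasure ν] (h0 : 0 ≤ w)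
    (h1 : w ≤ 1) : IsProbabilityMeasure (mixture w μ ν) := by
  constructor
  simp only [mixture, Measure.add_apply, Measure.smul_apply, measure_univ, smul_eq_mul, mul_one]
  rw [← ENNReal.ofReal_add h0 (by linarith)]
  simp

lemma integrable_mixture {f : ℝ → ℝ} (hμ : Integrable f μ) (hν : Integrable f ν) :
    Integrable f (mixture w μ ν) :=
  (hμ.smul_measure ENNReal.ofReal_ne_top).add_measure (hν.smul_measure ENNReal.ofReal_ne_top)

lemma integral_mixture {f : ℝ → ℝ} (h0 : 0 ≤ w) (h1 : w ≤ 1) (hμ : Integrable f μ)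
    (hν : Integrable f ν) :
    ∫ x, f x ∂(mixture w μ ν) = w * ∫ x, f x ∂μ + (1 - w) * ∫ x, f x ∂ν := by
  rw [mixture, integral_add_measure (hμ.smul_measure ENNReal.ofReal_ne_top)
    (hν.smul_measure ENNReal.ofReal_ne_top), integral_smul_measure, integral_smul_measure,
    ENNReal.toReal_ofReal h0, ENNReal.toReal_ofReal (by linarith)]
  rfl

lemma mixture_dirac_conv_gaussianReal (a b : ℝ) :
    (mixture w (Measure.dirac a) (Measure.dirac b)).conv (gaussianReal 0 1) =
      mixture w (gaussianReal a 1) (gaussianReal b 1) := by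
  have h (c : ℝ) : (Measure.dirac c).conv (gaussianReal 0 1) = gaussianReal c 1 := by
    rw [Measure.dirac_conv, gaussianReal_map_const_add, zero_add]
  rw [mixture, Measure.add_conv, Measure.conv_smul_left, Measure.conv_smul_left, h, h, mixture]

lemma smoothDensity_mixture_dirac (h0 : 0 ≤ w) (h1 : w ≤ 1) (a b y : ℝ) :
    smoothDensity (mixture w (Measure.dirac a) (Measure.dirac b)) y =
      ENNReal.ofReal (w * gaussianPDFReal 0 1 (y - a) + (1 - w) * gaussianPDFReal 0 1 (y - b)) := by
  have h1' : 0 ≤ 1 - w := by linarith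
  rw [smoothDensity, mixture, lintegral_add_measure, lintegral_smul_measure,
    lintegral_smul_measure, lintegral_dirac, lintegral_dirac, smul_eq_mul, smul_eq_mul,
    gaussianPDF, gaussianPDF, ← ENNReal.ofReal_mul h0, ← ENNReal.ofReal_mul h1',
    ← ENNReal.ofReal_add (mul_nonneg h0 (gaussianPDFReal_nonneg _ _ _))
      (mul_nonneg h1' (gaussianPDFReal_nonneg _ _ _))]

end

/-- The first input law: mass `99/100` at `0` and `1/100` at `1`. -/
noncomputable def firstInput : Measure ℝ := mixture (99 / 100) (Measure.dirac 0) (Measure.dirac 1)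

/-- The second input law, up to scaling: a skewed two-point law of mean `0` and variance `1`. -/
noncomputable def skewLaw : Measure ℝ :=
  mixture (4 / 5) (Measure.dirac (1 / 2)) (Measure.dirac (-2))

instance : IsProbabilityMeasure firstInput :=
  isProbabilityMeasure_mixture (by norm_num) (by norm_num)

instance : IsProbabilityMeasure skewLaw :=
  isProbabilityMeasure_mixture (by norm_num) (by norm_num)

lemma integrable_dirac_real (f : ℝ → ℝ) (a : ℝ) : Integrable f (Measure.dirac a) :=
  integrable_dirac (by simp)

lemma integrable_firstInput (f : ℝ → ℝ) : Integrable f firstInput :=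
  integrable_mixture (integrable_dirac_real f 0) (integrable_dirac_real f 1)

lemma integrable_skewLaw (f : ℝ → ℝ) : Integrable f skewLaw :=
  integrable_mixture (integrable_dirac_real f _) (integrable_dirac_real f _)

lemma integral_sq_firstInput : ∫ x, x ^ 2 ∂firstInput = 1 / 100 := by
  rw [firstInput, integral_mixture (by norm_num) (by norm_num) (integrable_dirac_real _ _)
    (integrable_dirac_real _ _)]
  simp; norm_num

lemma integral_sq_skewLaw : ∫ x, x ^ 2 ∂skewLaw = 1 := by
  rw [skewLaw, integral_mixture (by norm_num) (by norm_num) (integrable_dirac_real _ _)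
    (integrable_dirac_real _ _)]
  simp; norm_num

lemma skewLaw_conv_gaussianReal : skewLaw.conv (gaussianReal 0 1) =
    mixture (4 / 5) (gaussianReal (1 / 2) 1) (gaussianReal (-2) 1) :=
  mixture_dirac_conv_gaussianReal _ _

lemma integral_pow_skewLaw_conv (k : ℕ) : ∫ v, v ^ k ∂(skewLaw.conv (gaussianReal 0 1)) =
    4 / 5 * ∫ v, v ^ k ∂(gaussianReal (1 / 2) 1) + 1 / 5 * ∫ v, v ^ k ∂(gaussianReal (-2) 1) := by
  rw [skewLaw_conv_gaussianReal, integral_mixture (by norm_num) (by norm_num)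
    (integrable_pow_gaussianReal _ _ _) (integrable_pow_gaussianReal _ _ _)]
  norm_num

lemma integral_id_skewLaw_conv : ∫ v, v ∂(skewLaw.conv (gaussianReal 0 1)) = 0 := by
  have := integral_pow_skewLaw_conv 1
  simp only [pow_one, integral_id_gaussianReal] at this
  rw [this]; norm_num

lemma integral_sq_skewLaw_conv : ∫ v, v ^ 2 ∂(skewLaw.conv (gaussianReal 0 1)) = 2 := by
  rw [integral_pow_skewLaw_conv, integral_sq_gaussianReal, integral_sq_gaussianReal]; norm_num

lemma integral_cube_skewLaw_conv :
    ∫ v, v ^ 3 ∂(skewLaw.conv (gaussianReal 0 1)) = -(3 / 2) := by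
  rw [integral_pow_skewLaw_conv, integral_cube_gaussianReal, integral_cube_gaussianReal]; norm_num

lemma exists_integrable_exp_sq_skewLaw_conv : ∃ c, 0 < c ∧
    Integrable (fun v ↦ Real.exp (c * v ^ 2)) (skewLaw.conv (gaussianReal 0 1)) := by
  obtain ⟨a, ha, iA⟩ := IsGaussian.exists_integrable_exp_sq (gaussianReal (1 / 2) 1)
  obtain ⟨b, hb, iB⟩ := IsGaussian.exists_integrable_exp_sq (gaussianReal (-2) 1)
  simp only [Real.norm_eq_abs, sq_abs] at iA iB
  refine ⟨min a b, lt_min ha hb, ?_⟩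
  rw [skewLaw_conv_gaussianReal]
  refine integrable_mixture (iA.mono' (by fun_prop) (ae_of_all _ fun v ↦ ?_))
    (iB.mono' (by fun_prop) (ae_of_all _ fun v ↦ ?_)) <;>
  · rw [Real.norm_eq_abs, abs_of_pos (Real.exp_pos _)]
    gcongr
    first | exact min_le_left _ _ | exact min_le_right _ _

/-! ### Derivatives of the log-density of the smoothed first input -/

/-- The likelihood ratio of the smoothed first input to the standard Gaussian law. -/
noncomputable def tilt (y : ℝ) : ℝ := 99 / 100 + Real.exp (y - 1 / 2) / 100

/-- The posterior probability that the first input equals `1`. -/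
noncomputable def posteriorProb (y : ℝ) : ℝ := Real.exp (y - 1 / 2) / 100 / tilt y

lemma tilt_pos (y : ℝ) : 0 < tilt y := by unfold tilt; positivity

lemma posteriorProb_pos (y : ℝ) : 0 < posteriorProb y := div_pos (by positivity) (tilt_pos y)

lemma posteriorProb_lt_one (y : ℝ) : posteriorProb y < 1 := by
  rw [posteriorProb, div_lt_one (tilt_pos y), tilt]; linarith

lemma gaussianPDFReal_zero_one (y : ℝ) :
    gaussianPDFReal 0 1 y = (√(2 * Real.pi))⁻¹ * Real.exp (-y ^ 2 / 2) := by
  simp [gaussianPDFReal]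

lemma gaussianPDFReal_sub_one (y : ℝ) :
    gaussianPDFReal 0 1 (y - 1) = gaussianPDFReal 0 1 y * Real.exp (y - 1 / 2) := by
  rw [gaussianPDFReal_zero_one, gaussianPDFReal_zero_one, mul_assoc, ← Real.exp_add]
  ring_nf

/-- A squared exponential tilt is a shift by 2 up to the factor `e`, so the quadratic posterior term
has an explicit integrable majorant. -/
lemma exp_one_mul_gaussianPDFReal_sub_two (y : ℝ) :
    Real.exp 1 * gaussianPDFReal 0 1 (y - 2) =
      gaussianPDFReal 0 1 y * Real.exp (y - 1 / 2) ^ 2 := by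
  rw [gaussianPDFReal_zero_one, gaussianPDFReal_zero_one, mul_left_comm, mul_assoc, ← Real.exp_add,
    ← Real.exp_nat_mul, ← Real.exp_add]
  congr 2; push_cast; ring

lemma smoothDensity_firstInput (y : ℝ) :
    smoothDensity firstInput y = ENNReal.ofReal (gaussianPDFReal 0 1 y * tilt y) := by
  rw [firstInput, smoothDensity_mixture_dirac (by norm_num) (by norm_num), sub_zero,
    gaussianPDFReal_sub_one, tilt]
  congr 1; ring

lemma smoothDensity_firstInput_toReal (y : ℝ) :
    (smoothDensity firstInput y).toReal = gaussianPDFReal 0 1 y * tilt y := by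
  rw [smoothDensity_firstInput, ENNReal.toReal_ofReal
    (mul_nonneg (gaussianPDFReal_nonneg _ _ _) (tilt_pos y).le)]

lemma logDensity_firstInput (y : ℝ) :
    logDensity firstInput y = Real.log (√(2 * Real.pi))⁻¹ - y ^ 2 / 2 + Real.log (tilt y) := by
  rw [logDensity, smoothDensity_firstInput_toReal, Real.log_mul
    (gaussianPDFReal_pos _ _ _ one_ne_zero).ne' (tilt_pos y).ne', gaussianPDFReal_zero_one,
    Real.log_mul (by positivity) (Real.exp_pos _).ne', Real.log_exp]
  ring

lemma hasDerivAt_tilt (y : ℝ) : HasDerivAt tilt (Real.exp (y - 1 / 2) / 100) y := by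
  have := ((((hasDerivAt_id y).sub_const (1 / 2)).exp).div_const 100).const_add (99 / 100)
  exact this.congr_deriv (by simp)

/-- The posterior is a logistic function, so it solves the logistic equation. All further
derivatives are polynomials in a quantity between 0 and 1, hence bounded. -/
lemma hasDerivAt_posteriorProb (y : ℝ) :
    HasDerivAt posteriorProb (posteriorProb y - posteriorProb y ^ 2) y := by
  have h := ((((hasDerivAt_id y).sub_const (1 / 2)).exp).div_const 100)
  have := h.div (hasDerivAt_tilt y) (tilt_pos y).ne'
  refine this.congr_deriv ?_
  have := (tilt_pos y).ne'
  rw [posteriorProb]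
  simp only [id]
  field_simp

lemma hasDerivAt_logDensity_firstInput (y : ℝ) :
    HasDerivAt (logDensity firstInput) (-y + posteriorProb y) y := by
  rw [show logDensity firstInput = _ from funext logDensity_firstInput]
  have := ((((hasDerivAt_pow 2 y).div_const 2).const_sub (Real.log (√(2 * Real.pi))⁻¹))).add
    ((hasDerivAt_tilt y).log (tilt_pos y).ne')
  exact this.congr_deriv (by rw [posteriorProb]; push_cast; ring)

lemma hasDerivAt_neg_add_posteriorProb (y : ℝ) :
    HasDerivAt (fun y ↦ -y + posteriorProb y) (-1 + (posteriorProb y - posteriorProb y ^ 2)) y :=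
  (hasDerivAt_neg y).add (hasDerivAt_posteriorProb y)

lemma hasDerivAt_posteriorProb_sub_sq (y : ℝ) :
    HasDerivAt (fun y ↦ -1 + (posteriorProb y - posteriorProb y ^ 2))
      ((posteriorProb y - posteriorProb y ^ 2) * (1 - 2 * posteriorProb y)) y := by
  have h := hasDerivAt_posteriorProb y
  exact ((h.sub (h.pow 2)).const_add (-1)).congr_deriv (by push_cast; ring)

lemma hasDerivAt_posteriorProb_cubic (y : ℝ) :
    HasDerivAt (fun y ↦ (posteriorProb y - posteriorProb y ^ 2) * (1 - 2 * posteriorProb y))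
      ((posteriorProb y - posteriorProb y ^ 2) *
        (1 - 6 * posteriorProb y + 6 * posteriorProb y ^ 2)) y := by
  have h := hasDerivAt_posteriorProb y
  exact ((h.sub (h.pow 2)).mul ((h.const_mul 2).const_sub 1)).congr_deriv (by
    simp only [Pi.sub_apply, Pi.pow_apply]; push_cast; ring)

lemma continuous_posteriorProb : Continuous posteriorProb :=
  continuous_iff_continuousAt.2 fun y ↦ (hasDerivAt_posteriorProb y).continuousAt

lemma abs_posteriorProb_cubic_le (y : ℝ) :
    |(posteriorProb y - posteriorProb y ^ 2) * (1 - 2 * posteriorProb y)| ≤ 1 := by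
  have h0 := posteriorProb_pos y
  have h1 := posteriorProb_lt_one y
  rw [abs_mul]
  refine mul_le_one₀ ?_ (abs_nonneg _) ?_ <;> rw [abs_le] <;> constructor <;> nlinarith

lemma abs_posteriorProb_quartic_le (y : ℝ) :
    |(posteriorProb y - posteriorProb y ^ 2) *
      (1 - 6 * posteriorProb y + 6 * posteriorProb y ^ 2)| ≤ 1 := by
  have h0 := posteriorProb_pos y
  have h1 := posteriorProb_lt_one y
  rw [abs_mul]
  refine mul_le_one₀ ?_ (abs_nonneg _) ?_ <;> rw [abs_le] <;> constructor <;>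
    nlinarith [sq_nonneg (2 * posteriorProb y - 1)]

lemma integrable_posteriorProb_cubic {P : Measure ℝ} [IsProbabilityMeasure P] :
    Integrable (fun y ↦ (posteriorProb y - posteriorProb y ^ 2) * (1 - 2 * posteriorProb y)) P := by
  have := continuous_posteriorProb
  exact (integrable_const (1 : ℝ)).mono' (Continuous.aestronglyMeasurable (by fun_prop))
    (ae_of_all _ abs_posteriorProb_cubic_le)

lemma integrable_gaussianPDFReal_sub (a : ℝ) :
    Integrable (fun y ↦ gaussianPDFReal 0 1 (y - a)) :=
  (integrable_gaussianPDFReal 0 1).comp_sub_right a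

lemma integral_gaussianPDFReal_sub (a : ℝ) : ∫ y, gaussianPDFReal 0 1 (y - a) = 1 := by
  rw [integral_sub_right_eq_self (gaussianPDFReal 0 1),
    integral_gaussianPDFReal_eq_one 0 one_ne_zero]

/-- The third derivative of the log-density has positive mean. -/
lemma integral_posteriorProb_cubic_pos :
    0 < ∫ y, (posteriorProb y - posteriorProb y ^ 2) * (1 - 2 * posteriorProb y)
      ∂(firstInput.conv (gaussianReal 0 1)) := by
  set g : ℝ → ℝ := fun y ↦ (posteriorProb y - posteriorProb y ^ 2) * (1 - 2 * posteriorProb y)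
  have hi : Integrable g (firstInput.conv (gaussianReal 0 1)) := integrable_posteriorProb_cubic
  rw [conv_gaussianReal_eq_withDensity] at hi ⊢
  have hfin : ∀ᵐ y, smoothDensity firstInput y < ∞ :=
    ae_of_all _ fun y ↦ (smoothDensity_ne_top _ y).lt_top
  rw [integrable_withDensity_iff_integrable_smul' (by fun_prop) hfin] at hi
  rw [integral_withDensity_eq_integral_toReal_smul (by fun_prop) hfin]
  -- The integrand is `p - 3p² + 2p³`, times the density. The linear term is exact, the cubic one is
  -- dropped, and `tilt ≥ 99/100` bounds the quadratic one: `3 · e / 9900 = e / 3300`. The small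
  -- mass at 1 makes the linear term dominate.
  have hl : Integrable (fun y ↦ 1 / 100 * gaussianPDFReal 0 1 (y - 1) -
      Real.exp 1 / 3300 * gaussianPDFReal 0 1 (y - 2)) :=
    ((integrable_gaussianPDFReal_sub 1).const_mul _).sub
      ((integrable_gaussianPDFReal_sub 2).const_mul _)
  have hlI : ∫ y, (1 / 100 * gaussianPDFReal 0 1 (y - 1) -
      Real.exp 1 / 3300 * gaussianPDFReal 0 1 (y - 2)) = 1 / 100 - Real.exp 1 / 3300 := by
    rw [integral_sub ((integrable_gaussianPDFReal_sub 1).const_mul _)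
      ((integrable_gaussianPDFReal_sub 2).const_mul _), integral_const_mul, integral_const_mul,
      integral_gaussianPDFReal_sub, integral_gaussianPDFReal_sub, mul_one, mul_one]
  calc (0 : ℝ) < 1 / 100 - Real.exp 1 / 3300 := by linarith [Real.exp_one_lt_d9]
    _ ≤ _ := by
      rw [← hlI]
      refine integral_mono hl hi fun y ↦ ?_
      rw [smoothDensity_firstInput_toReal, smul_eq_mul]
      have hφ := gaussianPDFReal_pos 0 1 y one_ne_zero
      have hD := tilt_pos y
      have hD2 : 99 / 100 ≤ tilt y := by
        rw [tilt]; linarith [Real.exp_pos (y - 1 / 2)]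
      have hs : gaussianPDFReal 0 1 y * tilt y * posteriorProb y =
          1 / 100 * gaussianPDFReal 0 1 (y - 1) := by
        rw [gaussianPDFReal_sub_one, posteriorProb]; field_simp
      have hs2 : gaussianPDFReal 0 1 y * tilt y * posteriorProb y ^ 2 ≤
          Real.exp 1 / 9900 * gaussianPDFReal 0 1 (y - 2) := by
        rw [div_mul_eq_mul_div, exp_one_mul_gaussianPDFReal_sub_two]
        have e : gaussianPDFReal 0 1 y * tilt y * posteriorProb y ^ 2 =
            gaussianPDFReal 0 1 y * Real.exp (y - 1 / 2) ^ 2 / (10000 * tilt y) := by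
          rw [posteriorProb]; field_simp; norm_num
        rw [e]
        gcongr
        linarith
      have hp3 : 0 ≤ gaussianPDFReal 0 1 y * tilt y * posteriorProb y ^ 3 := by
        have := posteriorProb_pos y
        positivity
      nlinarith

/-! ### Choice of parameters and conclusion -/

/-- For small noise the skewed second input makes the entropy gap positive. -/
lemma exists_entropyGap_pos : ∃ ε : ℝ≥0, 0 < ε ∧
    0 < smoothEntropy (firstInput.conv ((skewLaw.conv (gaussianReal 0 1)).map ((ε : ℝ) * ·))) +
      smoothEntropy firstInput -
        2 * smoothEntropy (firstInput.conv ((gaussianReal 0 1).map ((ε : ℝ) * ·))) := by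
  obtain ⟨c, hc, hexp⟩ := exists_integrable_exp_sq_skewLaw_conv
  have hcont := continuous_posteriorProb
  have hb (y : ℝ) : ‖posteriorProb y - posteriorProb y ^ 2‖ ≤ 1 := by
    have h0 := posteriorProb_pos y
    have h1 := posteriorProb_lt_one y
    rw [Real.norm_eq_abs, abs_le]
    constructor <;> nlinarith
  have hid : Integrable (fun y ↦ y) (firstInput.conv (gaussianReal 0 1)) := by
    rw [firstInput, mixture_dirac_conv_gaussianReal]
    refine integrable_mixture ?_ ?_ <;> simpa using integrable_pow_gaussianReal _ 1 1
  have hp : Integrable posteriorProb (firstInput.conv (gaussianReal 0 1)) :=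
    (integrable_const (1 : ℝ)).mono' hcont.aestronglyMeasurable (ae_of_all _ fun y ↦ by
      rw [Real.norm_eq_abs, abs_of_pos (posteriorProb_pos y)]; exact (posteriorProb_lt_one y).le)
  have hq : Integrable (fun y ↦ posteriorProb y - posteriorProb y ^ 2)
      (firstInput.conv (gaussianReal 0 1)) :=
    (integrable_const (1 : ℝ)).mono' (Continuous.aestronglyMeasurable (by fun_prop))
      (ae_of_all _ hb)
  obtain ⟨C, hC⟩ := exists_entropyGap_ge (integrable_firstInput _) hc hexp
    integral_id_skewLaw_conv integral_sq_skewLaw_conv hasDerivAt_logDensity_firstInput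
    hasDerivAt_neg_add_posteriorProb hasDerivAt_posteriorProb_sub_sq hasDerivAt_posteriorProb_cubic
    abs_posteriorProb_quartic_le (hid.neg.add hp) ((integrable_const _).add hq)
    integrable_posteriorProb_cubic
  set I := ∫ y, (posteriorProb y - posteriorProb y ^ 2) * (1 - 2 * posteriorProb y)
    ∂(firstInput.conv (gaussianReal 0 1))
  have hI : 0 < I := integral_posteriorProb_cubic_pos
  have hden : 0 < 8 * (|C| + 1) := by positivity
  -- The leading term is `ε³ I / 4`, since `-(1/6)(-3/2) = 1/4`. The second bound keeps `C ε` below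
  -- `I / 4`; the first is what the `χ²` estimate needs.
  set ε := min (√c) (I / (8 * (|C| + 1)))
  have hε : 0 < ε := lt_min (Real.sqrt_pos.2 hc) (div_pos hI hden)
  refine ⟨⟨ε, hε.le⟩, hε, ?_⟩
  have h1 : ε ^ 2 ≤ c := by
    calc ε ^ 2 ≤ √c ^ 2 := by gcongr; exact min_le_left _ _
      _ = c := Real.sq_sqrt hc.le
  refine lt_of_lt_of_le ?_ (hC ε h1)
  rw [integral_cube_skewLaw_conv]
  have h2 : ε * (8 * (|C| + 1)) ≤ I := (le_div_iff₀ hden).1 (min_le_right _ _)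
  have h3 : C * ε < I / 4 := by
    nlinarith [mul_le_mul_of_nonneg_right (le_abs_self C) hε.le]
  have h4 := mul_lt_mul_of_pos_left h3 (pow_pos hε 3)
  nlinarith

theorem theorem1 :
    ∃ N₂ A₂ S₁ : ℝ≥0, N₂ = A₂ ∧ 0 < A₂ ∧ 0 < S₁ ∧
      -- the supremum over all admissible inputs is strictly positive
      0 < (⨆ P ∈ zFeasible A₂, zObjective 1 1 N₂ S₁ P) ∧
      -- the supremum over admissible inputs with Gaussian `X₂` (and any `X₁`) is not positive
      (⨆ P ∈ {P ∈ zFeasible A₂ | IsGaussian P.2}, zObjective 1 1 N₂ S₁ P) ≤ 0 ∧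
      -- the maximum is not attained by Gaussian `X₁` and `X₂`
      ¬ ∃ P ∈ zFeasible A₂, IsGaussian P.1 ∧ IsGaussian P.2 ∧
        IsMaxOn (zObjective 1 1 N₂ S₁) (zFeasible A₂) P := by
  obtain ⟨ε, hε, hgap⟩ := exists_entropyGap_pos
  set F := smoothEntropy (firstInput.conv ((skewLaw.conv (gaussianReal 0 1)).map ((ε : ℝ) * ·))) +
      smoothEntropy firstInput -
        2 * smoothEntropy (firstInput.conv ((gaussianReal 0 1).map ((ε : ℝ) * ·))) with hF
  set κ := skewLaw.map ((ε : ℝ) * ·) with hκ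
  have hκp : IsProbabilityMeasure κ := Measure.isProbabilityMeasure_map (by fun_prop)
  have hκ2 : Integrable (fun x ↦ x ^ 2) κ := by
    rw [hκ, integrable_map_measure (by fun_prop) (by fun_prop)]
    exact integrable_skewLaw _
  have hmom : secondMoment κ ≤ ((ε ^ 2 : ℝ≥0) : ℝ≥0∞) := by
    rw [secondMoment_eq_ofReal hκ2, hκ, integral_map (by fun_prop) (by fun_prop)]
    simp_rw [mul_pow]
    rw [integral_const_mul, integral_sq_skewLaw, mul_one, ← ENNReal.ofReal_coe_nnreal]
    simp
  have hg : gaussianReal 0 (ε ^ 2) = (gaussianReal 0 1).map ((ε : ℝ) * ·) := by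
    rw [gaussianReal_map_const_mul, mul_zero, mul_one]
    congr
  have hconv : κ.conv (gaussianReal 0 (ε ^ 2)) =
      (skewLaw.conv (gaussianReal 0 1)).map ((ε : ℝ) * ·) := by
    rw [hg]
    -- Scaling by `ε` is additive, so it commutes with convolution.
    exact (Measure.map_conv_addMonoidHom (AddMonoidHom.mulLeft (ε : ℝ))
      (measurable_const_mul (ε : ℝ))).symm
  have hmem : (firstInput, κ) ∈ zFeasible (ε ^ 2) := ⟨inferInstance, hκp, hmom⟩
  -- The price `S₁` is the gap `F` itself: as `E[X₁²] = 1/100`, the cost is one hundredth of the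
  -- gain.
  have hval : 0 < zObjective 1 1 (ε ^ 2) F.toNNReal (firstInput, κ) := by
    rw [zObjective_eq (integrable_firstInput _) hκ2, hconv, hg, integral_sq_firstInput, ← hF,
      Real.coe_toNNReal F hgap.le]
    have : 0 < F - F * (1 / 100) := by linarith
    exact_mod_cast this
  have hS : 0 < F.toNNReal := Real.toNNReal_pos.2 hgap
  refine ⟨ε ^ 2, ε ^ 2, F.toNNReal, rfl, pow_pos hε 2, hS,
    hval.trans_le (le_iSup₂_of_le _ hmem le_rfl), ?_, ?_⟩
  · refine iSup₂_le ?_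
    rintro ⟨μ, κ'⟩ ⟨⟨h1, -, h3⟩, h4⟩
    have : IsProbabilityMeasure μ := h1
    have : IsGaussian κ' := h4
    exact zObjective_gaussian_le hS h3
  · rintro ⟨⟨μ, κ'⟩, ⟨h1, -, h3⟩, -, h4, hmax⟩
    have : IsProbabilityMeasure μ := h1
    have : IsGaussian κ' := h4
    exact (hval.trans_le ((hmax hmem).trans (zObjective_gaussian_le hS h3))).false
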